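/- **Setting.** Let $K$ be a finite set of non-negative integers, $P=(P_k)_{k\in K}$ a probability distribution on $K$, $z=\sum_k kP_k$ and $Q_k=kP_k/z$. For all $k,k'$ let $F_k$ be (the distribution function of) a probability law on $[0,\infty)$ and $G_{kk'}$ a probability law on $[0,\infty)$, with density $g_{kk'}$ (possibly generalized). Consider the extended Watts model on the infinite configuration graph seen from a random node (the root): on a probability space there are a random locally finite rooted tree $\mathcal E$ (the skeleton), thresholds $\Phi_v\ge0$ of its nodes and weights $w_{vv'}=w_{v'v}\ge 0$ of its edges, such that, writing $k_v$ for the degree and $\mathcal N_v$ for the set of neighbours of $v$, * the root has degree $k$ with probability $P_k$; every edge, followed away from the root from a node of any given degree, leads to a node of degree $j$ with probability $Q_j$; * conditionally on $\mathcal E$, all thresholds and weights are mutually independent, $\Phi_v$ has distribution function $F_{k_v}$, and the weight of the edge from a node $v$ to a node $v'$ one step further from the root has law $G_{k_vk_{v'}}$. Put $\mathcal A_0=\{v:\Phi_v=0\}$ and $\mathcal A_n=\{v:\sum_{v'\in\mathcal N_v\cap\mathcal A_{n-1}}w_{v'v}\ge\Phi_v\}$ for $n\ge1$. For neighbours $v,v'$,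 "$v\in\mathcal A_n$ WOR $v'$" (without regarding $v'$) means that $v\in\mathcal A_n$ for the cascade on the subgraph obtained from $\mathcal E$ by deleting the edge $vv'$ and the entire connected subgraph hanging on it at $v'$. The model satisfies the *locally tree-like independence assumption* (LTIA) if, for any two connected sets $\mathcal N_1,\mathcal N_2$ of nodes (given by their positions in the rooted tree with ordered children) that share exactly one node $v$, the $\sigma$-algebras generated by the thresholds and degrees of the nodes of $\mathcal N_i$ and the edges, with their weights, inside $\mathcal N_i$ ($i=1,2$) are conditionally independent given $(\Phi_v,k_v)$. **Fourier pairing.** $\mathcal F(f)(\xi)=\int e^{-i\xi x}f(x)\,dx$, and $\mathcal F(m)(\xi)=\int e^{-i\xi x}\,dm(x)$ for a finite measure $m$. For a distribution function $F$, a finite measure $m$ and $j\ge0$, the pairing is understood as the limit $$\frac1{2\pi}\langle\mathcal F(F),\mathcal F(m)^j\rangle=\lim_{\varepsilon\downarrow0}\frac1{2\pi}\int_{-\infty}^\infty\overline{\mathcal F(e^{-\varepsilon|\cdot|}F)(\xi)}\;\mathcal F(m)(\xi)^j\;\mathcal F(\rho)(\varepsilon\xi)\,d\xi ,$$ where $\rho\in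 L^2$ is any probability density on $[0,\infty)$; it is part of the claims below that the integrals converge absolutely and that the limit exists and is the same for all $\rho$. **Theorem.** Let an extended Watts model as above satisfy LTIA. For a vector $C=(C_k)_{k\in K}$ with entries in $[0,1]$ write $$g_k[C]=\sum_{k'\in K}\bigl[(1-C_{k'})\,\delta_0+C_{k'}\,g_{kk'}\bigr]Q_{k'} .$$ Below, $k\in K$, and probabilities conditioned on $k_v=k$ are considered for $P_k>0$ only. 1. For every $n\ge 0$ and $k\ge1$ the probability $C^{(n)}_k=\mathbb P[v\in\mathcal A_n\text{ WOR }v'\mid k_v=k,\ v'\in\mathcal N_v]$ is the same for all pairs of positions $(v,v')$ of which one is the root and for which the condition has positive probability. With $g^{(n-1)}_k=g_k[C^{(n-1)}]$, $$C^{(n)}_k=\frac1{2\pi}\bigl\langle\mathcal F(F_k),\mathcal F(g^{(n-1)}_k)^{k-1}\bigr\rangle\quad(n\ge1),\qquad C^{(0)}_k=A^{(0)}_k=\mathbb P[\Phi_v=0\mid k_v=k]=F_k(0).$$ 2. For the root $v$, the probabilities $A^{(n)}_k=\mathbb P[v\in\mathcal A_n\mid k_v=k]$ satisfy $$A^{(n)}_k=\frac1{2\pi}\bigl\langle\mathcal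 F(F_k),\mathcal F(g^{(n-1)}_k)^{k}\bigr\rangle\quad(n\ge1).$$ 3. There is a vector $C^{(\infty)}$ with entries in $[0,1]$ that solves the fixed point equation $$C^{(\infty)}_k=\frac1{2\pi}\bigl\langle\mathcal F(F_k),\mathcal F(g_k[C^{(\infty)}])^{k-1}\bigr\rangle\qquad(k\in K,\ k\ge1),$$ with $C^{(n)}_k\to C^{(\infty)}_k$ as $n\to\infty$ whenever $k\ge1$ and $P_k>0$, such that the probability of eventual adoption $A^{(\infty)}_k=\mathbb P[v\in\bigcup_n\mathcal A_n\mid k_v=k]=\lim_{n\to\infty}A^{(n)}_k$ of the root $v$ is $$A^{(\infty)}_k=\frac1{2\pi}\bigl\langle\mathcal F(F_k),\mathcal F(g_k[C^{(\infty)}])^{k}\bigr\rangle .$$ -/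

import Mathlib

open MeasureTheory ProbabilityTheory Filter Topology

noncomputable section

namespace Watts

/-! Cascades on a weighted graph with thresholds (deterministic part). -/

section Cascade

variable {V : Type*}

/-- The adopters after `n` steps, for thresholds `thr` and edge weights `wt`. Early adopters are
the nodes with threshold `0`; afterwards a node adopts when the total weight of its edges to nodes
that had adopted one step earlier reaches its threshold. (For locally finite graphs.) -/
def adopters (E : SimpleGraph V) (thr : V → ℝ) (wt : Sym2 V → ℝ) : ℕ → Set V
  | 0 => {v | thr v = 0}
  | n + 1 => {v | thr v ≤ ∑ᶠ (v' : V) (_ : v' ∈ E.neighborSet v ∩ adopters E thr wt n),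
      wt s(v', v)}

/-- The subgraph obtained from `E` by deleting the edge from `v` to `v'` together with the entire
connected subgraph that hangs on this edge at `v'`. -/
def worGraph (E : SimpleGraph V) (v v' : V) : SimpleGraph V where
  Adj a b := (E.deleteEdges {s(v, v')}).Adj a b ∧ ¬ (E.deleteEdges {s(v, v')}).Reachable v' a
  symm := ⟨fun _ _ h => ⟨h.1.symm, fun hb => h.2 (hb.trans h.1.symm.reachable)⟩⟩
  loopless := ⟨fun _ h => h.1.ne rfl⟩

/-- `v` has adopted after `n` steps without regarding (WOR) its neighbour `v'`. -/
def AdoptsWOR (E : SimpleGraph V) (thr : V → ℝ) (wt : Sym2 V → ℝ) (n : ℕ) (v v' : V) : Prop :=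
  v ∈ adopters (worGraph E v v') thr wt n

end Cascade

/-! The skeleton graph, seen from a random node. -/

/-- Labels for the nodes of the skeleton seen from a random node: the random node itself has the
label `[]`, and the label `i :: u` is that of the `i`-th further neighbour of the node with label
`u` (Ulam-Harris labels). The labels that are not in use are isolated vertices. -/
abbrev Node := List ℕ

/-- The random node from which the network is seen. -/
abbrev root : Node := []

/-- The graph of all labels, in which each `i :: u` is joined to `u`. -/
def labelTree : SimpleGraph Node :=
  SimpleGraph.fromRel fun u v => v.tail = u

/-- `E` is a locally finite tree containing the root, written with Ulam-Harris labels. -/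
structure IsRootedTree (E : SimpleGraph Node) : Prop where
  le_labelTree : E ≤ labelTree
  rooted : ∀ (u : Node) (i : ℕ), E.Adj u (i :: u) → u ≠ root → E.Adj u.tail u
  consecutive : ∀ (u : Node) (i j : ℕ), j < i → E.Adj u (i :: u) → E.Adj u (j :: u)
  locallyFinite : ∀ u : Node, (E.neighborSet u).Finite

/-! The random model. -/

/-- The parameters: a degree distribution `P` on a finite set `K` of non-negative integers, the
laws `F k` on `[0, ∞)` of the threshold of a node of degree `k`, and the laws `G k k'` on `[0, ∞)`
of the weight of an edge whose ends have degrees `k` and `k'`. -/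
structure Params where
  K : Finset ℕ
  P : ℕ → ℝ
  P_nonneg : ∀ k ∈ K, 0 ≤ P k
  P_sum : ∑ k ∈ K, P k = 1
  F : ℕ → Measure ℝ
  F_prob : ∀ k, IsProbabilityMeasure (F k)
  F_nonneg : ∀ k, F k (Set.Iio 0) = 0
  G : ℕ → ℕ → Measure ℝ
  G_prob : ∀ k k', IsProbabilityMeasure (G k k')
  G_nonneg : ∀ k k', G k k' (Set.Iio 0) = 0

namespace Params

/-- The mean degree. -/
def z (p : Params) : ℝ := ∑ k ∈ p.K, k * p.P k

/-- The size-biased degree distribution: the degree of the node to which an edge leads. -/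
def Q (p : Params) (k : ℕ) : ℝ := k * p.P k / p.z

/-- The mixture `∑ k', ((1 - C k') δ₀ + C k' g_{k k'}) Q k'`. -/
def mixture (p : Params) (C : ℕ → ℝ) (k : ℕ) : Measure ℝ :=
  ∑ k' ∈ p.K, ENNReal.ofReal (p.Q k') •
    (ENNReal.ofReal (1 - C k') • Measure.dirac 0 + ENNReal.ofReal (C k') • p.G k k')

end Params

/-- The extended Watts model on the infinite configuration graph, seen from a random node:
a random skeleton graph, random thresholds of the nodes and random weights of the edges. -/
structure Model (p : Params) {Ω : Type*} [MeasurableSpace Ω] (μ : Measure Ω) where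
  /-- the skeleton graph -/
  skel : Ω → SimpleGraph Node
  /-- the thresholds -/
  thr : Ω → Node → ℝ
  /-- the edge weights -/
  wt : Ω → Sym2 Node → ℝ
  measurable_adj : ∀ u v, MeasurableSet {ω | (skel ω).Adj u v}
  measurable_thr : ∀ u, Measurable fun ω => thr ω u
  measurable_wt : ∀ e, Measurable fun ω => wt ω e
  thr_nonneg : ∀ ω u, 0 ≤ thr ω u
  wt_nonneg : ∀ ω e, 0 ≤ wt ω e
  isRootedTree : ∀ ω, IsRootedTree (skel ω)
  /-- the degree of a random node has the distribution `P` -/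
  root_law : ∀ k ∈ p.K, μ.real {ω | ((skel ω).neighborSet root).ncard = k} = p.P k
  /-- the half-edges are paired uniformly at random: whatever the degree of the node at its near
  end, an edge leads to a node of degree `j` with probability `j P j / z` -/
  edge_law : ∀ (u : Node) (i k : ℕ), ∀ j ∈ p.K,
    μ.real {ω | ((skel ω).neighborSet u).ncard = k ∧ (skel ω).Adj u (i :: u) ∧
        ((skel ω).neighborSet (i :: u)).ncard = j} =
      μ.real {ω | ((skel ω).neighborSet u).ncard = k ∧ (skel ω).Adj u (i :: u)} * p.Q j
  /-- conditionally on the skeleton, the thresholds of its nodes and the weights of its edges are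
  mutually independent; the threshold of a node of degree `k` has the law `F k`, and the weight of
  an edge whose ends have degrees `k`, `k'` has the law `G k k'` -/
  cond_law : ∀ (S T : Finset Node) (B D : Node → Set ℝ), (∀ u, MeasurableSet (B u)) →
    (∀ c, MeasurableSet (D c)) → ∀ᵐ ω ∂μ,
      (∀ u ∈ S, u = root ∨ 0 < ((skel ω).neighborSet u).ncard) →
      (∀ c ∈ T, (skel ω).Adj c.tail c) →
      (μ⟦{ω' | (∀ u ∈ S, thr ω' u ∈ B u) ∧ ∀ c ∈ T, wt ω' s(c.tail, c) ∈ D c} |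
          ⨆ (u : Node) (v : Node), MeasurableSpace.comap (fun ω' => (skel ω').Adj u v) ⊤⟧) ω =
        (∏ u ∈ S, (p.F ((skel ω).neighborSet u).ncard).real (B u)) *
          ∏ c ∈ T, (p.G ((skel ω).neighborSet c.tail).ncard
            ((skel ω).neighborSet c).ncard).real (D c)

namespace Model

variable {p : Params} {Ω : Type*} [MeasurableSpace Ω] {μ : Measure Ω} (M : Model p μ)

/-- The degree of `u` in the skeleton. -/
def deg (u : Node) (ω : Ω) : ℕ := ((M.skel ω).neighborSet u).ncard

/-- The set of realizations in which the label `u` belongs to a node of the network. -/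
def inUse (u : Node) : Set Ω := {ω | u = root ∨ 0 < M.deg u ω}

/-- The information on a set `S` of nodes: the degrees and thresholds of the nodes in `S`, and
the edges with both ends in `S`, with their weights. (Labels that are not in use and absent edges
carry no threshold and no weight.) -/
@[reducible] def info (S : Set Node) : MeasurableSpace Ω :=
  (⨆ u ∈ S, MeasurableSpace.comap (M.deg u) ⊤ ⊔
    MeasurableSpace.comap ((M.inUse u).indicator fun ω => M.thr ω u) (borel ℝ)) ⊔
  ⨆ u ∈ S, ⨆ v ∈ S, MeasurableSpace.comap (fun ω => (M.skel ω).Adj u v) ⊤ ⊔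
    MeasurableSpace.comap ({ω | (M.skel ω).Adj u v}.indicator fun ω => M.wt ω s(u, v)) (borel ℝ)

/-- The locally tree-like independence assumption: the information on two sets of nodes that share
exactly one node `v` is conditionally independent given the information located at `v`.
As labels record positions, sets of nodes are represented by connected sets of labels. -/
def LTIA : Prop :=
  ∀ (v : Node) (S₁ S₂ : Set Node), S₁ ∩ S₂ = {v} →
    (labelTree.induce S₁).Preconnected → (labelTree.induce S₂).Preconnected →
    ∀ A₁ A₂ : Set Ω, MeasurableSet[M.info S₁] A₁ → MeasurableSet[M.info S₂] A₂ →
      μ⟦A₁ ∩ A₂ | M.info {v}⟧ =ᵐ[μ] μ⟦A₁ | M.info {v}⟧ * μ⟦A₂ | M.info {v}⟧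

/-- `A⁽ⁿ⁾ₖ`: the probability that a random node of degree `k` has adopted after `n` steps. -/
def adoptProb (n k : ℕ) : ℝ :=
  (μ[|{ω | M.deg root ω = k}]).real {ω | root ∈ adopters (M.skel ω) (M.thr ω) (M.wt ω) n}

/-- `A⁽∞⁾ₖ`: the probability that a random node of degree `k` eventually adopts. -/
def eventualProb (k : ℕ) : ℝ :=
  (μ[|{ω | M.deg root ω = k}]).real
    {ω | ∃ n, root ∈ adopters (M.skel ω) (M.thr ω) (M.wt ω) n}

/-- The probability that `v` has adopted after `n` steps without regarding `v'`, given that `v` has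
degree `k` and that `v'` is a neighbour of `v`. -/
def worProb (n k : ℕ) (v v' : Node) : ℝ :=
  (μ[|{ω | M.deg v ω = k ∧ (M.skel ω).Adj v v'}]).real
    {ω | AdoptsWOR (M.skel ω) (M.thr ω) (M.wt ω) n v v'}

end Model

/-! Fourier transforms, in the convention with angular frequency. -/

/-- The Fourier transform of a function. -/
def fourierFun (f : ℝ → ℝ) (ξ : ℝ) : ℂ :=
  ∫ x : ℝ, Complex.exp (-(Complex.I * ξ * x)) * (f x : ℂ)

/-- The Fourier transform of a measure. -/
def fourierMeasure (m : Measure ℝ) (ξ : ℝ) : ℂ :=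
  ∫ x : ℝ, Complex.exp (-(Complex.I * ξ * x)) ∂m

/-- `(1 / 2π) ⟨ℱ f, h⟩ = c`, for a bounded function `f` (a distribution function) and the Fourier
transform `h` of a finite measure. Neither `f` nor `h` is integrable or square integrable in
general, so the pairing is a regularized one: `f` is damped at infinity by `e^{-ε|x|}`, and the
measure is convolved with the probability density `ρ(· / ε) / ε` on `[0, ∞)`. This makes the
integral absolutely convergent, and the limit for `ε → 0` has to be `c` whatever `ρ` is. The
smoothing is to the right as distribution functions are continuous from the right. -/
def HasFourierPairing (f : ℝ → ℝ) (h : ℝ → ℂ) (c : ℝ) : Prop :=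
  ∀ ρ : ℝ → ℝ, (∀ x, 0 ≤ ρ x) → (∀ x < 0, ρ x = 0) → Integrable ρ → ∫ x, ρ x = 1 →
    MemLp ρ 2 →
    (∀ ε > 0, Integrable fun ξ : ℝ =>
      (starRingEnd ℂ) (fourierFun (fun x => Real.exp (-(ε * |x|)) * f x) ξ) *
        (h ξ * fourierFun ρ (ε * ξ))) ∧
    Tendsto (fun ε : ℝ => (1 / (2 * (Real.pi : ℂ))) * ∫ ξ : ℝ,
      (starRingEnd ℂ) (fourierFun (fun x => Real.exp (-(ε * |x|)) * f x) ξ) *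
        (h ξ * fourierFun ρ (ε * ξ))) (𝓝[>] 0) (𝓝 (c : ℂ))

end Watts

end

/-! The Fourier expressions are expectations in disguise. The `j`-th power of the transform of a
finite measure is the transform of its `j`-fold convolution, and Parseval's identity turns the
regularized pairing into the integral of the distribution function against that convolution
(`hasFourierPairing_pow`). This integral, `Params.response`, is, when the mixture has mass 1, the
probability that a threshold with law `F k` is at most an independent sum of `j` independent
influences distributed as the mixture.

On a tree the cascade only has to be followed towards the root: a child that contributes to the
first adoption of its parent adopted before the parent did, hence without its help. So at a node
without an edge to a parent, adoption coincides with the downward recursion `AdoptsDown`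
(`mem_adopters_iff_adoptsDown`), and disregarding a neighbour means dropping the parent or one
child.

Downward adoption of a child is an event about its subtree. LTIA at the child separates this subtree
from the parent and the connecting edge; given the degree of the parent, the child's influence then
has the mixture law and is independent of the parent's threshold (`measureReal_contrib`). LTIA at
the parent separates the branches, so that the influences add up to a convolution power
(`measureReal_sum_contrib`, `measureReal_thr_le_sum`). Induction on the number of steps gives
`Params.worIter`, with `k - 1` relevant neighbours in the WOR case and `k` at the root.

Finally, the response is monotone and sequentially continuous in `C`. The iteration therefore
increases to a limit when `z ≠ 0` (and is constant after one step when `z = 0`), and the limit can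
be taken in the recursion and in the formula for the root. -/

noncomputable section

namespace Watts

/-! ### Parseval's identity for integrable and square integrable functions. -/

section Plancherel

open scoped FourierTransform

/-- The abstract transform on `L²` has to be identified with the integral. Both are locally
integrable and have equal integrals against test functions: duality of tempered distributions moves
the former onto the test function, Fubini's theorem the latter. -/
theorem coeFn_fourier_toLp_ae_eq {f : ℝ → ℂ} (hf : Integrable f) (hf2 : MemLp f 2) :
    (𝓕 (hf2.toLp f) : Lp ℂ 2 (volume : Measure ℝ)) =ᵐ[volume] 𝓕 f := by
  have hcont : Continuous (𝓕 f) :=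
    VectorFourier.fourierIntegral_continuous Real.continuous_fourierChar
      (by fun_prop) hf
  refine ae_eq_of_integral_contDiff_smul_eq
    ((Lp.memLp _).locallyIntegrable (by norm_num)) hcont.locallyIntegrable ?_
  intro g hg hgc
  have hgc' : HasCompactSupport fun x => (g x : ℂ) := hgc.comp_left Complex.ofReal_zero
  have hg' : ContDiff ℝ ((⊤ : ℕ∞) : WithTop ℕ∞) fun x => (g x : ℂ) :=
    Complex.ofRealCLM.contDiff.comp hg
  let φ : SchwartzMap ℝ ℂ := hgc'.toSchwartzMap hg'
  have hφ : ∀ x, φ x = g x := fun _ => rfl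
  have h1 := congrArg (fun T : TemperedDistribution ℝ ℂ => T φ)
    (Lp.fourier_toTemperedDistribution_eq (hf2.toLp f))
  simp only [TemperedDistribution.fourier_apply, Lp.toTemperedDistribution_apply] at h1
  have h2 : ∀ h : ℝ → ℂ, ∫ x, g x • h x = ∫ x, φ x • h x := by
    intro h; simp [hφ]
  rw [h2, h2, ← h1]
  have h3 : ∫ x, (𝓕 φ : SchwartzMap ℝ ℂ) x • (hf2.toLp f) x
      = ∫ x, (𝓕 φ : SchwartzMap ℝ ℂ) x • f x := by
    apply integral_congr_ae
    filter_upwards [hf2.coeFn_toLp] with x hx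
    rw [hx]
  rw [h3]
  have h4 := VectorFourier.integral_fourierIntegral_smul_eq_flip (μ := volume) (ν := volume)
    (L := innerₗ ℝ) Real.continuous_fourierChar (by fun_prop) φ.integrable hf
  rw [flip_innerₗ] at h4
  simpa [SchwartzMap.fourier_coe] using! h4

theorem memLp_fourier {f : ℝ → ℂ} (hf : Integrable f) (hf2 : MemLp f 2) : MemLp (𝓕 f) 2 :=
  (memLp_congr_ae (coeFn_fourier_toLp_ae_eq hf hf2)).1 (Lp.memLp _)

theorem integral_conj_fourier_mul_fourier {f g : ℝ → ℂ} (hf : Integrable f) (hf2 : MemLp f 2)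
    (hg : Integrable g) (hg2 : MemLp g 2) :
    ∫ x, (starRingEnd ℂ) (𝓕 f x) * 𝓕 g x = ∫ x, (starRingEnd ℂ) (f x) * g x := by
  have h := Lp.inner_fourier_eq (hf2.toLp f) (hg2.toLp g)
  rw [L2.inner_def, L2.inner_def] at h
  convert h using 1
  · apply integral_congr_ae
    filter_upwards [coeFn_fourier_toLp_ae_eq hf hf2, coeFn_fourier_toLp_ae_eq hg hg2] with x h1 h2
    rw [h1, h2, RCLike.inner_apply, mul_comm]
  · apply integral_congr_ae
    filter_upwards [hf2.coeFn_toLp, hg2.coeFn_toLp] with x h1 h2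
    rw [h1, h2, RCLike.inner_apply, mul_comm]

/-- This change of frequency unit is the source of the factor `1 / 2π` in the pairing. -/
theorem fourierFun_eq_fourier (f : ℝ → ℝ) (ξ : ℝ) :
    fourierFun f ξ = 𝓕 (fun x => (f x : ℂ)) (ξ / (2 * Real.pi)) := by
  rw [fourierFun, Real.fourier_real_eq_integral_exp_smul]
  congr 1; ext x
  rw [smul_eq_mul]
  congr 2
  push_cast
  have : (Real.pi : ℂ) ≠ 0 := by exact_mod_cast Real.pi_ne_zero
  field_simp

theorem integrable_conj_fourierFun_mul {f g : ℝ → ℝ} (hf : Integrable f) (hf2 : MemLp f 2)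
    (hg : Integrable g) (hg2 : MemLp g 2) :
    Integrable fun ξ => (starRingEnd ℂ) (fourierFun f ξ) * fourierFun g ξ := by
  have h1 := memLp_fourier hf.ofReal (hf2.ofReal (K := ℂ))
  have h2 := memLp_fourier hg.ofReal (hg2.ofReal (K := ℂ))
  have h := (h1.star.integrable_mul h2).comp_div (R := 2 * Real.pi) (by positivity)
  refine h.congr (ae_of_all _ fun ξ => ?_)
  simp [fourierFun_eq_fourier]

theorem integral_conj_fourierFun_mul {f g : ℝ → ℝ} (hf : Integrable f) (hf2 : MemLp f 2)
    (hg : Integrable g) (hg2 : MemLp g 2) :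
    1 / (2 * (Real.pi : ℂ)) * ∫ ξ, (starRingEnd ℂ) (fourierFun f ξ) * fourierFun g ξ =
      ((∫ x, f x * g x : ℝ) : ℂ) := by
  have h := integral_conj_fourier_mul_fourier hf.ofReal (hf2.ofReal (K := ℂ)) hg.ofReal
    (hg2.ofReal (K := ℂ))
  have hs := Measure.integral_comp_div (fun w => (starRingEnd ℂ) (𝓕 (fun x => (f x : ℂ)) w) *
    𝓕 (fun x => (g x : ℂ)) w) (2 * Real.pi)
  simp only [fourierFun_eq_fourier]
  rw [hs]
  erw [h]
  rw [abs_of_pos (by positivity), ← integral_complex_ofReal]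
  have : (Real.pi : ℂ) ≠ 0 := by exact_mod_cast Real.pi_ne_zero
  simp
  field_simp

end Plancherel

/-! ### The regularized pairing as an integral of the distribution function. -/

section Pairing

theorem fourierMeasure_eq_charFun (m : Measure ℝ) (ξ : ℝ) : fourierMeasure m ξ = charFun m (-ξ) := by
  rw [fourierMeasure, charFun_apply_real]
  congr 1; ext x
  congr 1; push_cast; ring

theorem continuous_fourierMeasure (m : Measure ℝ) [IsFiniteMeasure m] :
    Continuous (fourierMeasure m) := by
  have : fourierMeasure m = fun ξ => charFun m (-ξ) := funext (fourierMeasure_eq_charFun m)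
  rw [this]
  exact continuous_charFun.comp continuous_neg

theorem norm_fourierMeasure_le (m : Measure ℝ) (ξ : ℝ) : ‖fourierMeasure m ξ‖ ≤ m.real Set.univ := by
  rw [fourierMeasure_eq_charFun]; exact norm_charFun_le _

theorem integrable_exp_neg_mul_abs {ε : ℝ} (hε : 0 < ε) :
    Integrable fun x : ℝ => Real.exp (-(ε * |x|)) := by
  rw [← integrableOn_univ, ← Set.Iic_union_Ioi (a := (0 : ℝ))]
  refine IntegrableOn.union ?_ ?_
  · refine (integrableOn_exp_mul_Iic hε 0).congr_fun (fun x hx => ?_) measurableSet_Iic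
    simp [abs_of_nonpos (Set.mem_Iic.1 hx)]
  · refine (integrableOn_exp_mul_Ioi (neg_lt_zero.2 hε) 0).congr_fun (fun x hx => ?_)
      measurableSet_Ioi
    simp [abs_of_pos (Set.mem_Ioi.1 hx)]

variable {F : ℝ → ℝ} {ε : ℝ}

theorem abs_damped_le (hF : ∀ x, |F x| ≤ 1) (x : ℝ) :
    ‖Real.exp (-(ε * |x|)) * F x‖ ≤ Real.exp (-(ε * |x|)) := by
  rw [norm_mul, Real.norm_of_nonneg (Real.exp_pos _).le]
  exact mul_le_of_le_one_right (Real.exp_pos _).le (hF x)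

theorem integrable_damped (hFm : Measurable F) (hF : ∀ x, |F x| ≤ 1) (hε : 0 < ε) :
    Integrable fun x => Real.exp (-(ε * |x|)) * F x :=
  (integrable_exp_neg_mul_abs hε).mono' (by fun_prop) (ae_of_all _ (abs_damped_le hF))

theorem memLp_damped (hFm : Measurable F) (hF : ∀ x, |F x| ≤ 1) (hε : 0 < ε) :
    MemLp (fun x => Real.exp (-(ε * |x|)) * F x) 2 := by
  refine (memLp_two_iff_integrable_sq (by fun_prop)).2 ?_
  refine (integrable_exp_neg_mul_abs (ε := 2 * ε) (by positivity)).mono' (by fun_prop)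
    (ae_of_all _ fun x => ?_)
  rw [norm_pow]
  refine (pow_le_pow_left₀ (norm_nonneg _) (abs_damped_le hF x) 2).trans ?_
  rw [← Real.exp_nat_mul]
  apply le_of_eq; congr 1; push_cast; ring

variable {ρ : ℝ → ℝ}

/-- The function `ρ`, contracted by the factor `ε` and moved to start at `y`. -/
def rescale (ρ : ℝ → ℝ) (ε y x : ℝ) : ℝ := ε⁻¹ * ρ ((x - y) / ε)

theorem integrable_rescale (hρ : Integrable ρ) (hε : 0 < ε) (y : ℝ) :
    Integrable (rescale ρ ε y) :=
  ((hρ.comp_div hε.ne').comp_sub_right y).const_mul _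

theorem memLp_rescale (hρ : Integrable ρ) (hρ2 : MemLp ρ 2) (hε : 0 < ε) (y : ℝ) :
    MemLp (rescale ρ ε y) 2 := by
  refine (memLp_two_iff_integrable_sq (integrable_rescale hρ hε y).1).2 ?_
  have h := (memLp_two_iff_integrable_sq hρ.1).1 hρ2
  refine (((h.comp_div hε.ne').comp_sub_right y).const_mul ((ε⁻¹) ^ 2)).congr
    (ae_of_all _ fun x => ?_)
  simp [rescale, mul_pow]

theorem integral_comp_rescale (hε : 0 < ε) (y : ℝ) {E : Type*} [NormedAddCommGroup E]
    [NormedSpace ℝ E] (h : ℝ → E) :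
    ∫ x, ε⁻¹ • h ((x - y) / ε) = ∫ t, h t := by
  rw [integral_smul, integral_sub_right_eq_self (fun x => h (x / ε)) y,
    Measure.integral_comp_div h ε, abs_of_pos hε, inv_smul_smul₀ hε.ne']

theorem fourierFun_rescale (hε : 0 < ε) (y ξ : ℝ) :
    fourierFun (rescale ρ ε y) ξ = Complex.exp (-(Complex.I * ξ * y)) * fourierFun ρ (ε * ξ) := by
  rw [fourierFun, fourierFun, ← integral_const_mul]
  refine Eq.trans ?_ (integral_comp_rescale hε y _)
  congr 1; ext x
  have : (ε : ℂ) ≠ 0 := by exact_mod_cast hε.ne'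
  have h : -(Complex.I * ξ * x) =
      -(Complex.I * ξ * y) + -(Complex.I * (ε * ξ) * ((x - y) / ε)) := by
    field_simp; ring
  rw [h, Complex.exp_add, rescale, Complex.real_smul]
  push_cast
  ring

theorem integral_damped_mul_rescale (hε : 0 < ε) (y : ℝ) (f : ℝ → ℝ) :
    ∫ x, f x * rescale ρ ε y x = ∫ t, f (y + ε * t) * ρ t := by
  refine Eq.trans ?_ (integral_comp_rescale hε y _)
  congr 1; ext x
  simp only [rescale, smul_eq_mul]
  rw [mul_div_cancel₀ _ hε.ne', add_sub_cancel]; ring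

/-- By Parseval, pairing the damped `F` with the contracted density started at `y` gives an average
of the damped `F` over the points `y + ε t` with weight `ρ t`. Fubini integrates this over `y`, and
dominated convergence, used once for `t` and once for `y`, removes both regularizations. -/
theorem hasFourierPairing_measure (hFm : Measurable F) (hF : ∀ x, |F x| ≤ 1)
    (hFc : ∀ x, ContinuousWithinAt F (Set.Ici x) x) (m : Measure ℝ) [IsFiniteMeasure m] :
    HasFourierPairing F (fourierMeasure m) (∫ x, F x ∂m) := by
  intro ρ hρ0 hρneg hρ hρ1 hρ2
  have hbase : ∀ ε > 0, ∀ y : ℝ, Integrable fun ξ : ℝ =>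
      (starRingEnd ℂ) (fourierFun (fun x => Real.exp (-(ε * |x|)) * F x) ξ) *
        fourierFun (rescale ρ ε y) ξ := fun ε hε y =>
    integrable_conj_fourierFun_mul (integrable_damped hFm hF hε) (memLp_damped hFm hF hε)
      (integrable_rescale hρ hε y) (memLp_rescale hρ hρ2 hε y)
  have hbase0 : ∀ ε > 0, Integrable fun ξ : ℝ =>
      (starRingEnd ℂ) (fourierFun (fun x => Real.exp (-(ε * |x|)) * F x) ξ) *
        fourierFun ρ (ε * ξ) := by
    intro ε hε
    refine (hbase ε hε 0).congr (ae_of_all _ fun ξ => ?_)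
    simp [fourierFun_rescale hε]
  refine ⟨fun ε hε => ?_, ?_⟩
  · have := (hbase0 ε hε).bdd_mul (c := m.real Set.univ)
      (continuous_fourierMeasure m).aestronglyMeasurable
      (ae_of_all _ (norm_fourierMeasure_le m))
    refine this.congr (ae_of_all _ fun ξ => ?_)
    ring
  have hval : ∀ ε > 0, (1 / (2 * (Real.pi : ℂ))) * ∫ ξ : ℝ,
      (starRingEnd ℂ) (fourierFun (fun x => Real.exp (-(ε * |x|)) * F x) ξ) *
        (fourierMeasure m ξ * fourierFun ρ (ε * ξ)) =
      ((∫ y, (∫ t, (Real.exp (-(ε * |y + ε * t|)) * F (y + ε * t)) * ρ t) ∂m : ℝ) : ℂ) := by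
    intro ε hε
    -- The phase `exp (-iξy)` inside the transform of `m` is absorbed as a translation of the
    -- density by `y`.
    have h1 : ∀ ξ : ℝ, (starRingEnd ℂ) (fourierFun (fun x => Real.exp (-(ε * |x|)) * F x) ξ) *
        (fourierMeasure m ξ * fourierFun ρ (ε * ξ)) =
        ∫ y, (starRingEnd ℂ) (fourierFun (fun x => Real.exp (-(ε * |x|)) * F x) ξ) *
          fourierFun (rescale ρ ε y) ξ ∂m := by
      intro ξ
      simp only [fourierFun_rescale hε]
      rw [integral_const_mul, integral_mul_const]
      rfl
    simp only [h1]
    rw [integral_integral_swap, ← integral_const_mul, ← integral_complex_ofReal]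
    · congr 1; ext y
      rw [integral_conj_fourierFun_mul (integrable_damped hFm hF hε) (memLp_damped hFm hF hε)
        (integrable_rescale hρ hε y) (memLp_rescale hρ hρ2 hε y),
        integral_damped_mul_rescale hε y]
    · have := ((hbase0 ε hε).comp_fst m).bdd_mul (c := 1)
        (f := fun q : ℝ × ℝ => Complex.exp (-(Complex.I * q.1 * q.2)))
        (by fun_prop) (ae_of_all _ fun q => by
          have : -(Complex.I * q.1 * q.2) = ((-(q.1 * q.2) : ℝ) : ℂ) * Complex.I := by
            push_cast; ring
          rw [this, Complex.norm_exp_ofReal_mul_I])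
      refine this.congr (ae_of_all _ fun q => ?_)
      simp only [Function.uncurry, fourierFun_rescale hε]
      ring
  have hlim : Tendsto (fun ε : ℝ => ∫ y, (∫ t, (Real.exp (-(ε * |y + ε * t|)) * F (y + ε * t)) * ρ t) ∂m)
      (𝓝[>] 0) (𝓝 (∫ y, F y ∂m)) := by
    have hbound : ∀ ε > 0, ∀ y t : ℝ,
        ‖(Real.exp (-(ε * |y + ε * t|)) * F (y + ε * t)) * ρ t‖ ≤ ρ t := by
      intro ε hε y t
      rw [norm_mul, Real.norm_of_nonneg (hρ0 t)]
      refine mul_le_of_le_one_left (hρ0 t) ((abs_damped_le hF _).trans ?_)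
      rw [Real.exp_le_one_iff]
      have := mul_nonneg hε.le (abs_nonneg (y + ε * t))
      linarith
    refine tendsto_integral_filter_of_dominated_convergence (fun _ => 1) ?_ ?_ (integrable_const _) ?_
    · filter_upwards [self_mem_nhdsWithin] with ε hε
      have : AEStronglyMeasurable (fun q : ℝ × ℝ =>
          (Real.exp (-(ε * |q.1 + ε * q.2|)) * F (q.1 + ε * q.2)) * ρ q.2) (m.prod volume) :=
        (Measurable.aestronglyMeasurable (by fun_prop)).mul hρ.1.comp_snd
      exact this.integral_prod_right'
    · filter_upwards [self_mem_nhdsWithin] with ε hε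
      refine ae_of_all _ fun y => ?_
      exact (norm_integral_le_of_norm_le hρ (ae_of_all _ (hbound ε hε y))).trans_eq hρ1
    · refine ae_of_all _ fun y => ?_
      have h0 : F y = ∫ t, F y * ρ t := by rw [integral_const_mul, hρ1, mul_one]
      rw [h0]
      refine tendsto_integral_filter_of_dominated_convergence ρ ?_ ?_ hρ ?_
      · filter_upwards [self_mem_nhdsWithin] with ε hε
        exact (Measurable.aestronglyMeasurable (by fun_prop)).mul hρ.1
      · filter_upwards [self_mem_nhdsWithin] with ε hε
        exact ae_of_all _ (hbound ε hε y)
      · refine ae_of_all _ fun t => ?_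
        -- The points `y + ε t` approach `y` from the right, where `F` is continuous, only for `t ≥
        -- 0`; for other `t` the density vanishes.
        rcases lt_or_ge t 0 with ht | ht
        · simp [hρneg t ht]
        · refine Tendsto.mul_const _ ?_
          have hu : Tendsto (fun ε : ℝ => y + ε * t) (𝓝[>] 0) (𝓝[≥] y) := by
            refine tendsto_nhdsWithin_iff.2 ⟨?_, ?_⟩
            · have : Tendsto (fun ε : ℝ => y + ε * t) (𝓝 0) (𝓝 (y + 0 * t)) :=
                Continuous.tendsto (by fun_prop) 0
              simpa using this.mono_left nhdsWithin_le_nhds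
            · filter_upwards [self_mem_nhdsWithin] with ε hε
              exact le_add_of_nonneg_right (mul_nonneg (le_of_lt hε) ht)
          have he : Tendsto (fun ε : ℝ => Real.exp (-(ε * |y + ε * t|))) (𝓝[>] 0) (𝓝 1) := by
            have : Tendsto (fun ε : ℝ => Real.exp (-(ε * |y + ε * t|))) (𝓝 0)
                (𝓝 (Real.exp (-(0 * |y + 0 * t|)))) := Continuous.tendsto (by fun_prop) 0
            simpa using this.mono_left nhdsWithin_le_nhds
          simpa using he.mul ((hFc y).tendsto.comp hu)
  refine ((Complex.continuous_ofReal.tendsto _).comp hlim).congr' ?_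
  filter_upwards [self_mem_nhdsWithin] with ε hε
  exact (hval ε hε).symm

end Pairing

-- Convolution powers, the response function and its iteration.

attribute [instance] Params.F_prob Params.G_prob

/-- The convolution powers of a measure. -/
def convPow (m : Measure ℝ) : ℕ → Measure ℝ
  | 0 => Measure.dirac 0
  | j + 1 => (convPow m j).conv m

instance isFiniteMeasure_convPow (m : Measure ℝ) [IsFiniteMeasure m] :
    ∀ j, IsFiniteMeasure (convPow m j)
  | 0 => inferInstanceAs (IsFiniteMeasure (Measure.dirac 0))
  | j + 1 => by
    have := isFiniteMeasure_convPow m j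
    exact inferInstanceAs (IsFiniteMeasure ((convPow m j).conv m))

theorem fourierMeasure_convPow (m : Measure ℝ) [IsFiniteMeasure m] (ξ : ℝ) (j : ℕ) :
    fourierMeasure (convPow m j) ξ = fourierMeasure m ξ ^ j := by
  simp only [fourierMeasure_eq_charFun]
  induction j with
  | zero => simp [convPow]
  | succ j ih => rw [convPow, charFun_conv, ih, pow_succ]

theorem hasFourierPairing_pow (P : Measure ℝ) (m : Measure ℝ) [IsFiniteMeasure m] (j : ℕ) :
    HasFourierPairing (cdf P) (fun ξ => fourierMeasure m ξ ^ j) (∫ x, cdf P x ∂convPow m j) := by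
  simp only [← fourierMeasure_convPow]
  refine hasFourierPairing_measure (monotone_cdf P).measurable (fun x => ?_)
    (fun x => (cdf P).right_continuous x) _
  rw [abs_of_nonneg (cdf_nonneg P x)]
  exact cdf_le_one P x

namespace Params

variable (p : Params)

theorem Q_nonneg {k : ℕ} (hk : k ∈ p.K) : 0 ≤ p.Q k :=
  div_nonneg (mul_nonneg k.cast_nonneg (p.P_nonneg k hk))
    (Finset.sum_nonneg fun j hj => mul_nonneg j.cast_nonneg (p.P_nonneg j hj))

/-- The quotient is left unevaluated since it is 1 for `z ≠ 0` but 0 for `z = 0`, where the mixtures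
are the zero measure. -/
theorem sum_Q : ∑ k ∈ p.K, p.Q k = p.z / p.z := by
  simp only [Q, ← Finset.sum_div]; rfl

theorem sum_ofReal_Q_le_one : ∑ k ∈ p.K, ENNReal.ofReal (p.Q k) ≤ 1 := by
  rw [← ENNReal.ofReal_sum_of_nonneg fun k hk => p.Q_nonneg hk, p.sum_Q]
  exact ENNReal.ofReal_le_one.2 (div_self_le_one _)

theorem lintegral_mixture (C : ℕ → ℝ) (k : ℕ) (f : ℝ → ENNReal) :
    ∫⁻ x, f x ∂p.mixture C k = ∑ k' ∈ p.K, ENNReal.ofReal (p.Q k') *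
      (ENNReal.ofReal (1 - C k') * f 0 + ENNReal.ofReal (C k') * ∫⁻ x, f x ∂p.G k k') := by
  rw [mixture, lintegral_finsetSum_measure]
  simp [lintegral_smul_measure, lintegral_add_measure, mul_add]

instance isFiniteMeasure_mixture (C : ℕ → ℝ) (k : ℕ) : IsFiniteMeasure (p.mixture C k) := by
  refine ⟨?_⟩
  rw [← setLIntegral_one, Measure.restrict_univ, p.lintegral_mixture C k]
  refine ENNReal.sum_lt_top.2 fun k' _ => ENNReal.mul_lt_top ENNReal.ofReal_lt_top ?_
  simp

theorem mixture_univ_le_one {C : ℕ → ℝ} (hC : ∀ k ∈ p.K, C k ∈ Set.Icc (0 : ℝ) 1) (k : ℕ) :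
    p.mixture C k Set.univ ≤ 1 := by
  rw [← setLIntegral_one, Measure.restrict_univ, p.lintegral_mixture C k]
  refine (Finset.sum_le_sum fun k' hk' => ?_).trans p.sum_ofReal_Q_le_one
  simp only [mul_one, lintegral_const, measure_univ]
  rw [← ENNReal.ofReal_add (by linarith [(hC k' hk').2]) (hC k' hk').1]
  simp

theorem convPow_mixture_univ_le_one {C : ℕ → ℝ} (hC : ∀ k ∈ p.K, C k ∈ Set.Icc (0 : ℝ) 1)
    (k j : ℕ) : convPow (p.mixture C k) j Set.univ ≤ 1 := by
  induction j with
  | zero => simp [convPow]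
  | succ j ih =>
    rw [convPow, ← setLIntegral_one, Measure.restrict_univ, Measure.lintegral_conv measurable_const]
    simp only [lintegral_const, one_mul]
    exact mul_le_one' (p.mixture_univ_le_one hC k) ih

/-- The probability that a node of degree `k` adopts which has `j` further neighbours, when
neighbours of degree `k'` have adopted with probability `C k'`. -/
def response (C : ℕ → ℝ) (k j : ℕ) : ℝ := ∫ x, cdf (p.F k) x ∂convPow (p.mixture C k) j

theorem response_eq_toReal (C : ℕ → ℝ) (k j : ℕ) : p.response C k j =
    (∫⁻ x, ENNReal.ofReal (cdf (p.F k) x) ∂convPow (p.mixture C k) j).toReal :=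
  integral_eq_lintegral_of_nonneg_ae (ae_of_all _ (cdf_nonneg _))
    (monotone_cdf (p.F k)).measurable.aestronglyMeasurable

theorem lintegral_cdf_le_one {C : ℕ → ℝ} (hC : ∀ k ∈ p.K, C k ∈ Set.Icc (0 : ℝ) 1) (k j : ℕ) :
    ∫⁻ x, ENNReal.ofReal (cdf (p.F k) x) ∂convPow (p.mixture C k) j ≤ 1 := by
  refine (lintegral_mono fun x => ENNReal.ofReal_le_one.2 (cdf_le_one (p.F k) x)).trans ?_
  simpa using p.convPow_mixture_univ_le_one hC k j

theorem response_mem_Icc {C : ℕ → ℝ} (hC : ∀ k ∈ p.K, C k ∈ Set.Icc (0 : ℝ) 1) (k j : ℕ) :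
    p.response C k j ∈ Set.Icc (0 : ℝ) 1 := by
  rw [response_eq_toReal]
  exact ⟨ENNReal.toReal_nonneg, ENNReal.toReal_le_of_le_ofReal zero_le_one
    (by simpa using p.lintegral_cdf_le_one hC k j)⟩

theorem ae_nonneg_G (k k' : ℕ) : ∀ᵐ x ∂p.G k k', 0 ≤ x := by
  rw [ae_iff]
  simpa [Set.Iio] using p.G_nonneg k k'

/-- Raising `C k'` moves mass from the atom at 0 to `G k k'`, which lives on `[0, ∞)`, so a monotone
integrand can only gain. -/
theorem lintegral_mixture_mono {C C' : ℕ → ℝ} (h0 : ∀ k ∈ p.K, 0 ≤ C k)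
    (h1 : ∀ k ∈ p.K, C' k ≤ 1) (hCC : ∀ k ∈ p.K, C k ≤ C' k) (k : ℕ)
    {f : ℝ → ENNReal} (hf : Monotone f) :
    ∫⁻ x, f x ∂p.mixture C k ≤ ∫⁻ x, f x ∂p.mixture C' k := by
  rw [p.lintegral_mixture C k, p.lintegral_mixture C' k]
  refine Finset.sum_le_sum fun k' hk' => ?_
  gcongr ENNReal.ofReal (p.Q k') * ?_
  have h : f 0 ≤ ∫⁻ x, f x ∂p.G k k' := by
    calc f 0 = ∫⁻ _, f 0 ∂p.G k k' := by simp
      _ ≤ _ := lintegral_mono_ae ((p.ae_nonneg_G k k').mono fun x hx => hf hx)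
  have e1 : 1 - C k' = (1 - C' k') + (C' k' - C k') := by ring
  have e2 : C' k' = C k' + (C' k' - C k') := by ring
  have hd : 0 ≤ C' k' - C k' := sub_nonneg.2 (hCC k' hk')
  conv_rhs => rw [e2, ENNReal.ofReal_add (h0 k' hk') hd, ← e2]
  rw [e1, ENNReal.ofReal_add (sub_nonneg.2 (h1 k' hk')) hd, add_mul, add_mul, add_assoc]
  gcongr ENNReal.ofReal (1 - C' k') * f 0 + ?_
  rw [add_comm]
  gcongr

theorem lintegral_convPow_mixture_mono {C C' : ℕ → ℝ} (h0 : ∀ k ∈ p.K, 0 ≤ C k)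
    (h1 : ∀ k ∈ p.K, C' k ≤ 1) (hCC : ∀ k ∈ p.K, C k ≤ C' k) (k j : ℕ)
    {f : ℝ → ENNReal} (hf : Monotone f) :
    ∫⁻ x, f x ∂convPow (p.mixture C k) j ≤ ∫⁻ x, f x ∂convPow (p.mixture C' k) j := by
  induction j generalizing f with
  | zero => exact le_rfl
  | succ j ih =>
    rw [convPow, convPow, Measure.lintegral_conv hf.measurable, Measure.lintegral_conv hf.measurable]
    refine (lintegral_mono fun x => p.lintegral_mixture_mono h0 h1 hCC k
      fun a b hab => hf (add_le_add_right hab x)).trans (ih ?_)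
    exact fun a b hab => lintegral_mono fun y => hf (add_le_add_left hab y)

theorem response_mono {C C' : ℕ → ℝ} (h0 : ∀ k ∈ p.K, C k ∈ Set.Icc (0 : ℝ) 1)
    (h1 : ∀ k ∈ p.K, C' k ∈ Set.Icc (0 : ℝ) 1) (hCC : ∀ k ∈ p.K, C k ≤ C' k) (k j : ℕ) :
    p.response C k j ≤ p.response C' k j := by
  rw [response_eq_toReal, response_eq_toReal]
  refine ENNReal.toReal_mono (ne_top_of_le_ne_top ENNReal.one_ne_top
    (p.lintegral_cdf_le_one h1 k j)) ?_
  exact p.lintegral_convPow_mixture_mono (fun i hi => (h0 i hi).1) (fun i hi => (h1 i hi).2) hCC k j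
    fun a b hab => ENNReal.ofReal_le_ofReal (monotone_cdf _ hab)

/-- The integrand varies with `n` for the sake of the induction: splitting off one convolution
factor leaves an inner integral that depends on `n`. Only the weights of the mixtures move, so the
integrands need not be continuous. -/
theorem tendsto_lintegral_convPow_mixture {C : ℕ → ℕ → ℝ} {L : ℕ → ℝ}
    (hC : ∀ n, ∀ k ∈ p.K, C n k ∈ Set.Icc (0 : ℝ) 1)
    (hL : ∀ k ∈ p.K, Tendsto (fun n => C n k) atTop (𝓝 (L k))) (k j : ℕ)
    {f : ℕ → ℝ → ENNReal} {g : ℝ → ENNReal} (hf : ∀ n, Measurable (f n)) (hf1 : ∀ n x, f n x ≤ 1)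
    (hg : Measurable g) (hfg : ∀ x, Tendsto (fun n => f n x) atTop (𝓝 (g x))) :
    Tendsto (fun n => ∫⁻ x, f n x ∂convPow (p.mixture (C n) k) j) atTop
      (𝓝 (∫⁻ x, g x ∂convPow (p.mixture L k) j)) := by
  induction j generalizing f g with
  | zero =>
    simp only [convPow]
    simpa [lintegral_dirac' _ (hf _), lintegral_dirac' _ hg] using hfg 0
  | succ j ih =>
    simp only [convPow, Measure.lintegral_conv (hf _), Measure.lintegral_conv hg]
    refine ih (f := fun n x => ∫⁻ y, f n (x + y) ∂p.mixture (C n) k) (fun n => ?_) (fun n x => ?_)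
      ?_ (fun x => ?_)
    · exact Measurable.lintegral_prod_right' (f := fun q : ℝ × ℝ => f n (q.1 + q.2))
        ((hf n).comp measurable_add)
    · refine (lintegral_mono fun y => hf1 n _).trans ?_
      simpa using p.mixture_univ_le_one (hC n) k
    · exact Measurable.lintegral_prod_right' (f := fun q : ℝ × ℝ => g (q.1 + q.2))
        (hg.comp measurable_add)
    · have hm : ∀ n, Measurable fun y => f n (x + y) := fun n => (hf n).comp (by fun_prop)
      simp only [p.lintegral_mixture _ k]
      have hg1 : ∀ x, g x ≤ 1 := fun x => le_of_tendsto' (hfg x) fun n => hf1 n x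
      refine tendsto_finsetSum _ fun k' hk' => ENNReal.Tendsto.const_mul ?_
        (Or.inr ENNReal.ofReal_ne_top)
      refine Tendsto.add (ENNReal.Tendsto.mul ?_ (Or.inr ?_) (hfg _) (Or.inr ENNReal.ofReal_ne_top))
        (ENNReal.Tendsto.mul ?_ (Or.inr ?_) ?_ (Or.inr ENNReal.ofReal_ne_top))
      · exact ENNReal.tendsto_ofReal (tendsto_const_nhds.sub (hL k' hk'))
      · exact ne_top_of_le_ne_top ENNReal.one_ne_top (hg1 _)
      · exact ENNReal.tendsto_ofReal (hL k' hk')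
      · refine ne_top_of_le_ne_top ENNReal.one_ne_top ((lintegral_mono fun y => hg1 _).trans ?_)
        simp
      · refine tendsto_lintegral_of_dominated_convergence (fun _ => 1) hm
          (fun n => ae_of_all _ fun y => hf1 n _) (by simp) (ae_of_all _ fun y => hfg _)

theorem tendsto_response {C : ℕ → ℕ → ℝ} {L : ℕ → ℝ}
    (hC : ∀ n, ∀ k ∈ p.K, C n k ∈ Set.Icc (0 : ℝ) 1)
    (hL : ∀ k ∈ p.K, Tendsto (fun n => C n k) atTop (𝓝 (L k))) (k j : ℕ) :
    Tendsto (fun n => p.response (C n) k j) atTop (𝓝 (p.response L k j)) := by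
  simp only [response_eq_toReal]
  have hLm : ∀ i ∈ p.K, L i ∈ Set.Icc (0 : ℝ) 1 := fun i hi =>
    isClosed_Icc.mem_of_tendsto (hL i hi) (Eventually.of_forall fun n => hC n i hi)
  refine (ENNReal.tendsto_toReal (ne_top_of_le_ne_top ENNReal.one_ne_top
    (p.lintegral_cdf_le_one hLm k j))).comp ?_
  have hm : Measurable fun x => ENNReal.ofReal (cdf (p.F k) x) :=
    (monotone_cdf (p.F k)).measurable.ennreal_ofReal
  exact p.tendsto_lintegral_convPow_mixture hC hL k j (fun _ => hm)
    (fun _ x => ENNReal.ofReal_le_one.2 (cdf_le_one (p.F k) x)) hm fun _ => tendsto_const_nhds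

/-- The probabilities of adoption without regarding one neighbour, by recursion. -/
def worIter : ℕ → ℕ → ℝ
  | 0, k => cdf (p.F k) 0
  | n + 1, k => p.response (worIter n) k (k - 1)

theorem worIter_mem_Icc : ∀ n k, p.worIter n k ∈ Set.Icc (0 : ℝ) 1
  | 0, _ => ⟨cdf_nonneg _ _, cdf_le_one _ _⟩
  | n + 1, k => p.response_mem_Icc (fun i _ => worIter_mem_Icc n i) k _

theorem convPow_dirac_zero : ∀ j, convPow (Measure.dirac 0) j = Measure.dirac 0
  | 0 => rfl
  | j + 1 => by rw [convPow, convPow_dirac_zero j, Measure.conv_dirac_zero]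

theorem mixture_zero (hz : p.z ≠ 0) (k : ℕ) : p.mixture 0 k = Measure.dirac 0 := by
  simp only [mixture, Pi.zero_apply, sub_zero, ENNReal.ofReal_one, one_smul, ENNReal.ofReal_zero,
    zero_smul, add_zero]
  rw [← Finset.sum_smul, ← ENNReal.ofReal_sum_of_nonneg fun k hk => p.Q_nonneg hk, p.sum_Q,
    div_self hz, ENNReal.ofReal_one, one_smul]

theorem mixture_eq_zero (hz : p.z = 0) (C : ℕ → ℝ) (k : ℕ) : p.mixture C k = 0 := by
  simp [mixture, Q, hz]

/-- The initial value is the response to `C = 0`, whose mixture is `δ₀`; from there monotonicity of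
the response propagates the inequality. -/
theorem worIter_le_succ (hz : p.z ≠ 0) : ∀ n k, p.worIter n k ≤ p.worIter (n + 1) k
  | 0, k => by
    have h := p.response_mono (C := 0) (C' := p.worIter 0) (fun _ _ => by simp)
      (fun i _ => p.worIter_mem_Icc 0 i) (fun i _ => (p.worIter_mem_Icc 0 i).1) k (k - 1)
    rw [response, p.mixture_zero hz, convPow_dirac_zero, integral_dirac] at h
    exact h
  | n + 1, k => p.response_mono (fun i _ => p.worIter_mem_Icc n i)
      (fun i _ => p.worIter_mem_Icc (n + 1) i) (fun i _ => worIter_le_succ hz n i) k _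

theorem exists_tendsto_worIter : ∃ L : ℕ → ℝ,
    ∀ k, Tendsto (fun n => p.worIter n k) atTop (𝓝 (L k)) := by
  refine Classical.axiomOfChoice (r := fun k l => Tendsto (fun n => p.worIter n k) atTop (𝓝 l))
    fun k => ?_
  by_cases hz : p.z = 0
  -- The mixture is zero whatever `C` is, so the iteration is constant from the first step on.
  · refine ⟨p.worIter 1 k, (tendsto_add_atTop_iff_nat 1).1 (tendsto_const_nhds.congr fun n => ?_)⟩
    simp only [worIter, response, p.mixture_eq_zero hz]
  · exact ⟨_, tendsto_atTop_ciSup (monotone_nat_of_le_succ fun n => p.worIter_le_succ hz n k)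
      ⟨1, by rintro _ ⟨n, rfl⟩; exact (p.worIter_mem_Icc n k).2⟩⟩

end Params

/-! ### Cascades on a tree, followed towards the root. -/

section Deterministic

/-- Adoption after `n` steps when influence is only passed towards the root. -/
def AdoptsDown (E : SimpleGraph Node) (thr : Node → ℝ) (wt : Sym2 Node → ℝ) : ℕ → Node → Prop
  | 0, u => thr u = 0
  | n + 1, u => thr u ≤ ∑ᶠ (i : ℕ) (_ : E.Adj u (i :: u) ∧ AdoptsDown E thr wt n (i :: u)),
      wt s(u, i :: u)

variable {E : SimpleGraph Node} {thr : Node → ℝ} {wt : Sym2 Node → ℝ}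

theorem labelTree_adj {u v : Node} : labelTree.Adj u v ↔ u ≠ v ∧ (u.tail = v ∨ v.tail = u) :=
  SimpleGraph.fromRel_adj (fun u v : Node => v.tail = u) u v |>.trans (by rw [or_comm])

theorem eq_cons_of_tail_eq {u v : Node} (hne : u ≠ v) (h : v.tail = u) : ∃ i, v = i :: u := by
  cases v with
  | nil => exact absurd h.symm hne
  | cons i w => exact ⟨i, by rw [← h, List.tail_cons]⟩

theorem adj_cases (hE : E ≤ labelTree) {u v : Node} (h : E.Adj u v) :
    v = u.tail ∨ ∃ i, v = i :: u := by
  obtain ⟨hne, h | h⟩ := labelTree_adj.1 (hE h)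
  · exact Or.inl h.symm
  · exact Or.inr (eq_cons_of_tail_eq hne h)

theorem finsum_mem_le_finsum_mem {ι : Type*} {s t : Set ι} {f : ι → ℝ} (ht : t.Finite) (hst : s ⊆ t)
    (hf : ∀ i, 0 ≤ f i) : ∑ᶠ i ∈ s, f i ≤ ∑ᶠ i ∈ t, f i := by
  rw [finsum_mem_eq_finite_toFinset_sum _ ht, finsum_mem_eq_finite_toFinset_sum _ (ht.subset hst)]
  refine Finset.sum_le_sum_of_subset_of_nonneg (fun i hi => ?_) fun i _ _ => hf i
  simpa using hst (by simpa using hi)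

theorem finite_children (hf : ∀ u, (E.neighborSet u).Finite) (u : Node) :
    {i | E.Adj u (i :: u)}.Finite :=
  (hf u).preimage (f := fun i => i :: u) (fun _ _ _ _ h => (List.cons.inj h).1)

theorem adopters_subset_succ (hf : ∀ u, (E.neighborSet u).Finite) (hw : ∀ e, 0 ≤ wt e) :
    ∀ n, adopters E thr wt n ⊆ adopters E thr wt (n + 1)
  | 0, v, hv => by
    change thr v ≤ _
    rw [show thr v = 0 from hv]
    exact finsum_nonneg fun _ => finsum_nonneg fun _ => hw _
  | n + 1, v, hv => le_trans (show thr v ≤ _ from hv)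
      (finsum_mem_le_finsum_mem ((hf v).subset Set.inter_subset_left)
        (Set.inter_subset_inter_right _ (adopters_subset_succ hf hw n)) fun _ => hw _)

theorem adopters_mono (hf : ∀ u, (E.neighborSet u).Finite) (hw : ∀ e, 0 ≤ wt e) :
    Monotone (adopters E thr wt) :=
  monotone_nat_of_le_succ (adopters_subset_succ hf hw)

theorem AdoptsDown.succ (hf : ∀ u, (E.neighborSet u).Finite) (hw : ∀ e, 0 ≤ wt e) :
    ∀ {n u}, AdoptsDown E thr wt n u → AdoptsDown E thr wt (n + 1) u
  | 0, u, hv => by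
    change thr u ≤ _
    rw [show thr u = 0 from hv]
    exact finsum_nonneg fun _ => finsum_nonneg fun _ => hw _
  | n + 1, u, hv => le_trans (show thr u ≤ _ from hv)
      (finsum_mem_le_finsum_mem (s := {i | E.Adj u (i :: u) ∧ AdoptsDown E thr wt n (i :: u)})
        (t := {i | E.Adj u (i :: u) ∧ AdoptsDown E thr wt (n + 1) (i :: u)})
        ((finite_children hf u).subset fun _ h => h.1)
        (fun _ h => ⟨h.1, AdoptsDown.succ hf hw h.2⟩) fun _ => hw _)

theorem finsum_children_eq (u : Node) (A : Set Node) :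
    ∑ᶠ (i : ℕ) (_ : E.Adj u (i :: u) ∧ i :: u ∈ A), wt s(u, i :: u) =
      ∑ᶠ v' ∈ {v' | (E.Adj u v' ∧ v' ∈ A) ∧ ∃ i, v' = i :: u}, wt s(v', u) := by
  have hinj : Set.InjOn (fun i : ℕ => i :: u) {i | E.Adj u (i :: u) ∧ i :: u ∈ A} :=
    fun _ _ _ _ h => (List.cons.inj h).1
  have h := finsum_mem_image (f := fun v' => wt s(v', u)) hinj
  have himg : (fun i : ℕ => i :: u) '' {i | E.Adj u (i :: u) ∧ i :: u ∈ A} =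
      {v' | (E.Adj u v' ∧ v' ∈ A) ∧ ∃ i, v' = i :: u} := by
    ext v'
    constructor
    · rintro ⟨i, hi, rfl⟩; exact ⟨hi, i, rfl⟩
    · rintro ⟨h, i, rfl⟩; exact ⟨i, h, rfl⟩
  rw [himg] at h
  rw [h]
  simp only [Sym2.eq_swap, Set.mem_ofPred_eq]

theorem AdoptsDown.mem_adopters (hf : ∀ u, (E.neighborSet u).Finite) (hw : ∀ e, 0 ≤ wt e) :
    ∀ {n u}, AdoptsDown E thr wt n u → u ∈ adopters E thr wt n
  | 0, _, h => h
  | n + 1, u, h => by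
    refine le_trans (show thr u ≤ _ from h) ?_
    refine (finsum_mem_le_finsum_mem (s := {i | E.Adj u (i :: u) ∧ AdoptsDown E thr wt n (i :: u)})
      (t := {i | E.Adj u (i :: u) ∧ i :: u ∈ adopters E thr wt n})
      ((finite_children hf u).subset fun _ h => h.1)
      (fun _ h => ⟨h.1, AdoptsDown.mem_adopters hf hw h.2⟩) fun _ => hw _).trans ?_
    refine (finsum_children_eq u (adopters E thr wt n)).trans_le ?_
    exact finsum_mem_le_finsum_mem ((hf u).subset Set.inter_subset_left) (fun _ h => h.1)
      fun _ => hw _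

/-- The hypothesis says that the parent has not adopted in time to help. If `u` adopts for the first
time at step `n + 1`, its influence comes from children that had adopted by step `n`; as `u` was not
an adopter then, the same hypothesis holds for each of these children. If `u` adopted earlier, the
induction applies directly. -/
theorem adoptsDown_of_mem_adopters (hE : E ≤ labelTree) (hf : ∀ u, (E.neighborSet u).Finite)
    (hw : ∀ e, 0 ≤ wt e) : ∀ {n u}, u ∈ adopters E thr wt n →
      (E.Adj u u.tail → ∀ m < n, u.tail ∉ adopters E thr wt m) → AdoptsDown E thr wt n u
  | 0, _, h, _ => h
  | n + 1, u, h, hp => by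
    by_cases hn : u ∈ adopters E thr wt n
    · exact AdoptsDown.succ hf hw (adoptsDown_of_mem_adopters hE hf hw hn
        fun ha m hm => hp ha m (hm.trans n.lt_succ_self))
    · refine le_trans (show thr u ≤ _ from h) ?_
      have hsub : E.neighborSet u ∩ adopters E thr wt n ⊆
          {v' | (E.Adj u v' ∧ v' ∈ adopters E thr wt n) ∧ ∃ i, v' = i :: u} := by
        rintro v' ⟨ha, hA⟩
        refine ⟨⟨ha, hA⟩, ?_⟩
        rcases adj_cases hE ha with rfl | hi
        · exact absurd hA (hp ha n n.lt_succ_self)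
        · exact hi
      refine (finsum_mem_le_finsum_mem ((hf u).subset fun _ h => h.1.1) hsub
        fun _ => hw _).trans ?_
      rw [← finsum_children_eq]
      refine finsum_mem_le_finsum_mem (s := {i | E.Adj u (i :: u) ∧ i :: u ∈ adopters E thr wt n})
        (t := {i | E.Adj u (i :: u) ∧ AdoptsDown E thr wt n (i :: u)})
        ((finite_children hf u).subset fun _ h => h.1)
        (fun i h => ⟨h.1, adoptsDown_of_mem_adopters hE hf hw h.2 fun _ m hm hm' => hn ?_⟩)
        fun _ => hw _
      exact adopters_mono hf hw hm.le hm'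

theorem mem_adopters_iff_adoptsDown (hE : E ≤ labelTree) (hf : ∀ u, (E.neighborSet u).Finite)
    (hw : ∀ e, 0 ≤ wt e) {n : ℕ} {u : Node} (hu : ¬ E.Adj u u.tail) :
    u ∈ adopters E thr wt n ↔ AdoptsDown E thr wt n u :=
  ⟨fun h => adoptsDown_of_mem_adopters hE hf hw h fun h => absurd h hu,
    AdoptsDown.mem_adopters hf hw⟩

theorem adoptsDown_congr {H : SimpleGraph Node} : ∀ {n : ℕ} {u : Node},
    (∀ v, u <:+ v → ∀ i, H.Adj v (i :: v) ↔ E.Adj v (i :: v)) →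
    (AdoptsDown H thr wt n u ↔ AdoptsDown E thr wt n u)
  | 0, _, _ => Iff.rfl
  | n + 1, u, h => by
    have : ∀ i, (H.Adj u (i :: u) ∧ AdoptsDown H thr wt n (i :: u)) ↔
        (E.Adj u (i :: u) ∧ AdoptsDown E thr wt n (i :: u)) := fun i =>
      and_congr (h u List.suffix_rfl i)
        (adoptsDown_congr fun v hv => h v ((List.suffix_cons i u).trans hv))
    simp only [AdoptsDown, this]

theorem worGraph_le (u v : Node) : worGraph E u v ≤ E := fun _ _ h => by
  have := h.1
  rw [SimpleGraph.deleteEdges_adj] at this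
  exact this.1

theorem worGraph_adj {u v a b : Node} : (worGraph E u v).Adj a b ↔
    (E.deleteEdges {s(u, v)}).Adj a b ∧ ¬ (E.deleteEdges {s(u, v)}).Reachable v a := Iff.rfl

/-- The edge between the root and `[i]` is the only edge of the label tree that crosses the boundary
of the subtree at `[i]`; deleting it disconnects the two sides. -/
theorem suffix_iff_of_adj (hE : E ≤ labelTree) {i : ℕ} {a b : Node} (h : E.Adj a b)
    (hne : s(a, b) ≠ s([], [i])) : [i] <:+ a ↔ [i] <:+ b := by
  have key : ∀ {a : Node} {j : ℕ}, s(a, j :: a) ≠ s([], [i]) → ([i] <:+ a ↔ [i] <:+ j :: a) := by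
    intro a j hne
    rw [List.suffix_cons_iff]
    constructor
    · exact Or.inr
    · rintro (h | h)
      · obtain ⟨rfl, rfl⟩ := List.cons.inj h
        exact absurd rfl hne
      · exact h
  obtain ⟨hn, h | h⟩ := labelTree_adj.1 (hE h)
  · obtain ⟨j, rfl⟩ := eq_cons_of_tail_eq hn.symm h
    exact (key (by rwa [Sym2.eq_swap])).symm
  · obtain ⟨j, rfl⟩ := eq_cons_of_tail_eq hn h
    exact key hne

theorem suffix_iff_of_reachable (hE : E ≤ labelTree) {i : ℕ} {a b : Node}
    (h : (E.deleteEdges {s([], [i])}).Reachable a b) : [i] <:+ a ↔ [i] <:+ b := by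
  obtain ⟨w⟩ := h
  induction w with
  | nil => rfl
  | cons h _ ih =>
    rw [SimpleGraph.deleteEdges_adj] at h
    exact (suffix_iff_of_adj hE h.1 h.2).trans ih

theorem adoptsWOR_child (hE : IsRootedTree E) (hw : ∀ e, 0 ≤ wt e) (n i : ℕ) :
    AdoptsWOR E thr wt n [i] root ↔ AdoptsDown E thr wt n [i] := by
  have hle := (worGraph_le (E := E) [i] root).trans hE.le_labelTree
  have hf : ∀ u, ((worGraph E [i] root).neighborSet u).Finite := fun u =>
    (hE.locallyFinite u).subset fun v hv => worGraph_le _ _ hv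
  rw [AdoptsWOR, mem_adopters_iff_adoptsDown hle hf hw]
  · refine adoptsDown_congr fun v hv j => ⟨fun h => worGraph_le _ _ h, fun h => ?_⟩
    rw [worGraph_adj, SimpleGraph.deleteEdges_adj, Sym2.eq_swap]
    refine ⟨⟨h, ?_⟩, fun hr => ?_⟩
    · intro he
      rw [Set.mem_singleton_iff, Sym2.eq_iff] at he
      rcases he with ⟨rfl, _⟩ | ⟨rfl, h2⟩
      · simp at hv
      · simp at h2
    · rw [← suffix_iff_of_reachable hE.le_labelTree hr] at hv
      simp at hv
  · intro h
    rw [worGraph_adj, SimpleGraph.deleteEdges_adj] at h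
    exact h.1.2 rfl

theorem adoptsWOR_root_succ (hE : IsRootedTree E) (hw : ∀ e, 0 ≤ wt e) (n i : ℕ) :
    AdoptsWOR E thr wt (n + 1) root [i] ↔ thr root ≤
      ∑ᶠ (j : ℕ) (_ : (E.Adj root [j] ∧ AdoptsDown E thr wt n [j]) ∧ j ≠ i), wt s(root, [j]) := by
  have hle := (worGraph_le (E := E) root [i]).trans hE.le_labelTree
  have hf : ∀ u, ((worGraph E root [i]).neighborSet u).Finite := fun u =>
    (hE.locallyFinite u).subset fun v hv => worGraph_le _ _ hv
  have hns : ∀ {a}, ¬ [i] <:+ a → ¬ (E.deleteEdges {s(root, [i])}).Reachable [i] a := fun ha hr =>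
    ha ((suffix_iff_of_reachable hE.le_labelTree hr).1 List.suffix_rfl)
  -- The empty label is its own tail, so an edge from the root to its parent would be a loop.
  rw [AdoptsWOR, mem_adopters_iff_adoptsDown hle hf hw (fun h => h.ne rfl)]
  have key : ∀ j, ((worGraph E root [i]).Adj root [j] ∧
      AdoptsDown (worGraph E root [i]) thr wt n [j]) ↔
      ((E.Adj root [j] ∧ AdoptsDown E thr wt n [j]) ∧ j ≠ i) := by
    intro j
    have hadj : (worGraph E root [i]).Adj root [j] ↔ E.Adj root [j] ∧ j ≠ i := by
      rw [worGraph_adj, SimpleGraph.deleteEdges_adj, and_iff_left (hns (by simp))]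
      simp
    rw [hadj]
    by_cases hji : j = i
    · simp [hji]
    · rw [adoptsDown_congr (E := E)]
      · tauto
      · intro v hv l
        refine ⟨fun h => worGraph_le _ _ h, fun h => ?_⟩
        have hv' : ¬ [i] <:+ v := by
          intro h
          rcases List.suffix_or_suffix_of_suffix h hv with h | h <;>
            · have := h.eq_of_length rfl
              simp_all
        rw [worGraph_adj, SimpleGraph.deleteEdges_adj]
        refine ⟨⟨h, fun he => ?_⟩, hns hv'⟩
        rw [Set.mem_singleton_iff, Sym2.eq_iff] at he
        rcases he with ⟨rfl, _⟩ | ⟨rfl, _⟩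
        · simp at hv
        · exact hv' List.suffix_rfl
  simp only [AdoptsDown, key]

theorem mem_adopters_root (hE : IsRootedTree E) (hw : ∀ e, 0 ≤ wt e) (n : ℕ) :
    root ∈ adopters E thr wt n ↔ AdoptsDown E thr wt n root :=
  mem_adopters_iff_adoptsDown hE.le_labelTree hE.locallyFinite hw fun h => h.ne rfl

end Deterministic

/-! ### Ulam-Harris trees: degrees, children and connected sets of labels. -/

section Tree

/-- The number of children of a node in use with label `u` and degree `k`. -/
def numChildren (u : Node) (k : ℕ) : ℕ := if u = root then k else k - 1

variable {E : SimpleGraph Node}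

theorem eq_Iio_ncard {I : Set ℕ} (hI : I.Finite) (h : ∀ i ∈ I, ∀ j < i, j ∈ I) (i : ℕ) :
    i ∈ I ↔ i < I.ncard := by
  classical
  have hex : ∃ m, m ∉ I := hI.infinite_compl.nonempty
  have hIio : I = Set.Iio (Nat.find hex) := by
    ext i
    refine ⟨fun hi => ?_, fun hi => not_not.1 (Nat.find_min hex hi)⟩
    by_contra hle
    rcases (not_lt.1 fun h : i < Nat.find hex => hle h).eq_or_lt with he | hlt
    · exact Nat.find_spec hex (he ▸ hi)
    · exact Nat.find_spec hex (h i hi _ hlt)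
  have : I.ncard = Nat.find hex := by
    conv_lhs => rw [hIio]
    rw [← Nat.card_coe_set_eq]; simp
  rw [this]; conv_lhs => rw [hIio]
  rfl

theorem IsRootedTree.adj_child_iff (hE : IsRootedTree E) (u : Node) (i : ℕ) :
    E.Adj u (i :: u) ↔ i < {i | E.Adj u (i :: u)}.ncard :=
  eq_Iio_ncard (finite_children hE.locallyFinite u) (fun i hi j hj => hE.consecutive u i j hj hi) i

theorem IsRootedTree.ncard_neighborSet (hE : IsRootedTree E) (u : Node) [Decidable (E.Adj u u.tail)] :
    (E.neighborSet u).ncard = {i | E.Adj u (i :: u)}.ncard + if E.Adj u u.tail then 1 else 0 := by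
  have himg : ((fun i : ℕ => i :: u) '' {i | E.Adj u (i :: u)}).ncard =
      {i | E.Adj u (i :: u)}.ncard := Set.ncard_image_of_injective _
    fun _ _ h => (List.cons.inj h).1
  have hsub : E.neighborSet u = ((fun i : ℕ => i :: u) '' {i | E.Adj u (i :: u)}) ∪
      {v | v = u.tail ∧ E.Adj u u.tail} := by
    ext v
    constructor
    · intro h
      rcases adj_cases hE.le_labelTree h with rfl | ⟨i, rfl⟩
      · exact Or.inr ⟨rfl, h⟩
      · exact Or.inl ⟨i, h, rfl⟩
    · rintro (⟨i, h, rfl⟩ | ⟨rfl, h⟩) <;> exact h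
  split_ifs with h
  · have h1 : {v | v = u.tail ∧ E.Adj u u.tail} = {u.tail} := by ext v; simp [h]
    rw [hsub, h1, Set.union_singleton, Set.ncard_insert_of_notMem _
      ((finite_children hE.locallyFinite u).image _), himg]
    rintro ⟨i, _, hi⟩
    have := congrArg List.length hi
    simp at this
    omega
  · have h1 : {v | v = u.tail ∧ E.Adj u u.tail} = ∅ := by ext v; simp [h]
    rw [hsub, h1, Set.union_empty, himg, add_zero]

theorem IsRootedTree.adj_tail (hE : IsRootedTree E) {u : Node} (hu : u ≠ root)
    (h : 0 < (E.neighborSet u).ncard) : E.Adj u.tail u := by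
  obtain ⟨v, hv⟩ := Set.nonempty_of_ncard_ne_zero h.ne'
  rcases adj_cases hE.le_labelTree hv with rfl | ⟨i, rfl⟩
  · exact SimpleGraph.Adj.symm hv
  · exact hE.rooted u i hv hu

theorem IsRootedTree.ncard_pos_of_adj (hE : IsRootedTree E) {u v : Node} (h : E.Adj u v) :
    0 < (E.neighborSet u).ncard :=
  (Set.ncard_pos (hE.locallyFinite u)).2 ⟨v, h⟩

/-- Children are numbered consecutively, and away from the root one unit of the degree belongs to
the parent. Hence the degree of a node in use decides which edges to children are present. -/
theorem IsRootedTree.adj_child_iff_lt (hE : IsRootedTree E) {u : Node}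
    (h : u = root ∨ 0 < (E.neighborSet u).ncard) (i : ℕ) :
    E.Adj u (i :: u) ↔ i < numChildren u (E.neighborSet u).ncard := by
  classical
  rw [hE.adj_child_iff, numChildren, hE.ncard_neighborSet u]
  by_cases hu : u = root
  · subst hu
    simp
  · have := (hE.adj_tail hu (h.resolve_left hu)).symm
    simp [hu, this]

theorem IsRootedTree.adj_root_of_adj (hE : IsRootedTree E) :
    ∀ {u : Node} {i : ℕ}, E.Adj u (i :: u) → 0 < (E.neighborSet root).ncard
  | [], _, h => hE.ncard_pos_of_adj h
  | _ :: _, _, h => IsRootedTree.adj_root_of_adj hE (hE.rooted _ _ h (List.cons_ne_nil _ _))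

/-- Passing repeatedly to the parent stays in `S` and has to end at `v`, since labels get shorter.
-/
theorem preconnected_of_tail_mem {S : Set Node} {v : Node} (hv : v ∈ S)
    (h : ∀ a ∈ S, a ≠ v → a ≠ [] ∧ a.tail ∈ S) : (labelTree.induce S).Preconnected := by
  have key : ∀ (n : ℕ) (a : Node) (ha : a ∈ S), a.length = n →
      (labelTree.induce S).Reachable ⟨a, ha⟩ ⟨v, hv⟩ := by
    intro n
    induction n with
    | zero =>
      intro a ha hn
      have : a = v := by
        by_contra hne
        exact (h a ha hne).1 (List.length_eq_zero_iff.1 hn)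
      subst this; rfl
    | succ n ih =>
      intro a ha hn
      by_cases hne : a = v
      · subst hne; rfl
      · obtain ⟨h0, ht⟩ := h a ha hne
        refine SimpleGraph.Reachable.trans (SimpleGraph.Adj.reachable ?_) (ih a.tail ht (by simp [hn]))
        rw [SimpleGraph.induce_adj, labelTree_adj]
        refine ⟨fun he => ?_, Or.inl rfl⟩
        have := congrArg List.length he
        simp at this
        omega
  exact fun a b => (key _ a.1 a.2 rfl).trans (key _ b.1 b.2 rfl).symm

/-- The labels of a node and of its descendants. -/
def subtree (u : Node) : Set Node := {a | u <:+ a}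

/-- A node together with the subtrees at some of its children. -/
def branches (u : Node) (I : Set ℕ) : Set Node := {u} ∪ ⋃ i ∈ I, subtree (i :: u)

theorem tail_mem_subtree {u a : Node} (ha : a ∈ subtree u) (hne : a ≠ u) :
    a ≠ [] ∧ a.tail ∈ subtree u := by
  cases a with
  | nil => exact absurd (List.suffix_nil.1 ha).symm hne
  | cons i a =>
    refine ⟨List.cons_ne_nil _ _, ?_⟩
    rcases List.suffix_cons_iff.1 ha with h | h
    · exact absurd h.symm hne
    · exact h

theorem preconnected_subtree (u : Node) : (labelTree.induce (subtree u)).Preconnected :=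
  preconnected_of_tail_mem (v := u) List.suffix_rfl fun _ => tail_mem_subtree

theorem preconnected_branches (u : Node) (I : Set ℕ) :
    (labelTree.induce (branches u I)).Preconnected := by
  refine preconnected_of_tail_mem (v := u) (Or.inl rfl) fun a ha hne => ?_
  obtain ⟨i, hi, ha⟩ := Set.mem_iUnion₂.1 (ha.resolve_left hne)
  by_cases hai : a = i :: u
  · subst hai
    exact ⟨List.cons_ne_nil _ _, Or.inl rfl⟩
  · have := tail_mem_subtree ha hai
    exact ⟨this.1, Or.inr (Set.mem_iUnion₂.2 ⟨i, hi, this.2⟩)⟩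

theorem preconnected_pair (u : Node) (i : ℕ) :
    (labelTree.induce {u, i :: u}).Preconnected := by
  refine preconnected_of_tail_mem (v := u) (Or.inl rfl) fun a ha hne => ?_
  rw [Set.mem_singleton_iff.1 (ha.resolve_left hne)]
  exact ⟨List.cons_ne_nil _ _, Or.inl rfl⟩

theorem notMem_subtree_cons (u : Node) (i : ℕ) : u ∉ subtree (i :: u) := fun h => by
  have := List.IsSuffix.length_le h
  simp at this

theorem pair_inter_subtree (u : Node) (i : ℕ) :
    ({u, i :: u} : Set Node) ∩ subtree (i :: u) = {i :: u} := by
  ext a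
  constructor
  · rintro ⟨rfl | h, h2⟩
    · exact absurd h2 (notMem_subtree_cons _ _)
    · exact h
  · rintro rfl
    exact ⟨Or.inr rfl, List.suffix_rfl⟩

theorem branches_inter_branches (u : Node) {I J : Set ℕ} (h : Disjoint I J) :
    branches u I ∩ branches u J = {u} := by
  ext a
  constructor
  · rintro ⟨h1 | h1, h2⟩
    · exact h1
    · rcases h2 with h2 | h2
      · exact h2
      · obtain ⟨i, hi, hai⟩ := Set.mem_iUnion₂.1 h1
        obtain ⟨j, hj, haj⟩ := Set.mem_iUnion₂.1 h2
        have : i = j := by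
          rcases List.suffix_or_suffix_of_suffix hai haj with h | h
          · exact (List.cons.inj (h.eq_of_length (by simp))).1
          · exact (List.cons.inj (h.eq_of_length (by simp))).1.symm
        subst this
        exact absurd hj (Set.disjoint_left.1 h hi)
  · rintro rfl
    exact ⟨Or.inl rfl, Or.inl rfl⟩

theorem subtree_subset_branches {u : Node} {I : Set ℕ} {i : ℕ} (hi : i ∈ I) :
    subtree (i :: u) ⊆ branches u I :=
  fun _ ha => Or.inr (Set.mem_iUnion₂.2 ⟨i, hi, ha⟩)

theorem child_subtree_subset (u : Node) (i : ℕ) : subtree (i :: u) ⊆ subtree u :=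
  fun _ ha => (List.suffix_cons i u).trans ha

end Tree

/-! ### From conditional independence to product formulas. -/

section CondIndep

variable {Ω : Type*} {m mΩ : MeasurableSpace Ω} {μ : Measure Ω} [IsProbabilityMeasure μ]

theorem setIntegral_condExp_indicator (hm : m ≤ mΩ) {A G : Set Ω} (hA : MeasurableSet[mΩ] A)
    (hG : MeasurableSet[m] G) : ∫ ω in G, (μ⟦A | m⟧) ω ∂μ = μ.real (A ∩ G) := by
  rw [setIntegral_condExp hm ((integrable_const 1).indicator hA) hG, integral_indicator_const _ hA]
  simp [measureReal_restrict_apply hA]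

/-- If `A₁` and `A₂` are conditionally independent, and the conditional probability of `A₁` is the
constant `c` on `H`, then `A₁` is independent of `A₂` on the events contained in `H`. -/
theorem measureReal_inter_of_condIndep (hm : m ≤ mΩ) {A₁ A₂ H : Set Ω}
    (hA₁ : MeasurableSet[mΩ] A₁) (hA₂ : MeasurableSet[mΩ] A₂) (hH : MeasurableSet[m] H)
    (h : μ⟦A₁ ∩ A₂ | m⟧ =ᵐ[μ] μ⟦A₁ | m⟧ * μ⟦A₂ | m⟧) {c : ℝ}
    (hc : ∀ G, MeasurableSet[m] G → G ⊆ H → μ.real (A₁ ∩ G) = c * μ.real G)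
    {G : Set Ω} (hG : MeasurableSet[m] G) (hGH : G ⊆ H) :
    μ.real (A₁ ∩ A₂ ∩ G) = c * μ.real (A₂ ∩ G) := by
  -- On `H` the conditional probability equals `c`, because both have the same integral over every
  -- `m`-measurable part of `H`.
  have hconst : (fun ω => H.indicator (fun _ => c) ω) =ᵐ[μ] H.indicator (μ⟦A₁ | m⟧) := by
    refine EventuallyEq.trans ?_ (condExp_indicator ((integrable_const 1).indicator hA₁) hH)
    refine ae_eq_condExp_of_forall_setIntegral_eq hm
      (((integrable_const 1).indicator hA₁).indicator (hm _ hH)) ?_ ?_ ?_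
    · exact fun s _ _ => ((integrable_const c).indicator (hm _ hH)).integrableOn
    · intro s hs _
      rw [Set.indicator_indicator, integral_indicator_const _ ((hm _ hH).inter hA₁),
        integral_indicator_const _ (hm _ hH), measureReal_restrict_apply (hm _ hH),
        measureReal_restrict_apply ((hm _ hH).inter hA₁)]
      have := hc (H ∩ s) (hH.inter hs) Set.inter_subset_left
      rw [smul_eq_mul, smul_eq_mul, mul_one, mul_comm, ← this]
      congr 1
      ext; simp; tauto
    · exact (stronglyMeasurable_const.indicator hH).aestronglyMeasurable
  rw [← setIntegral_condExp_indicator hm (hA₁.inter hA₂) hG,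
    ← setIntegral_condExp_indicator hm hA₂ hG, ← integral_const_mul]
  refine setIntegral_congr_ae (hm _ hG) ?_
  filter_upwards [h, hconst] with ω h1 h2 hω
  rw [Set.indicator_of_mem (hGH hω), Set.indicator_of_mem (hGH hω)] at h2
  rw [h1, Pi.mul_apply, ← h2]

end CondIndep

section JointLaw

variable {Ω : Type*} [MeasurableSpace Ω] {ν : Measure Ω} [IsFiniteMeasure ν]

theorem map_prodMk_eq_prod {X Y : Ω → ℝ} (hX : Measurable X) (hY : Measurable Y)
    {α β : Measure ℝ} [IsFiniteMeasure α] [IsFiniteMeasure β]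
    (h : ∀ A B, MeasurableSet A → MeasurableSet B →
      ν.real (X ⁻¹' A ∩ Y ⁻¹' B) = α.real A * β.real B) :
    ν.map (fun ω => (X ω, Y ω)) = α.prod β := by
  symm
  refine Measure.prod_eq fun A B hA hB => ?_
  rw [Measure.map_apply (hX.prodMk hY) (hA.prod hB), Set.mk_preimage_prod]
  have := h A B hA hB
  rw [measureReal_def, measureReal_def, measureReal_def, ← ENNReal.toReal_mul] at this
  exact (ENNReal.toReal_eq_toReal_iff' (measure_ne_top _ _)
    (ENNReal.mul_ne_top (measure_ne_top _ _) (measure_ne_top _ _))).1 this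

theorem measurable_sum_range {d : Ω → ℕ} (hd : Measurable d) {X : ℕ → Ω → ℝ}
    (hX : ∀ i, Measurable (X i)) : Measurable fun ω => ∑ i ∈ Finset.range (d ω), X i ω := by
  have : Measurable fun q : ℕ × Ω => ∑ i ∈ Finset.range q.1, X i q.2 :=
    measurable_from_prod_countable_right fun k =>
      (Finset.range k).measurable_fun_sum fun i _ => hX i
  exact this.comp (hd.prodMk measurable_id)

end JointLaw

/-- The number of children exceeds `i` exactly when the edge to child `i` is present. The σ-algebra
is arbitrary so that the one generated by the skeleton is covered. -/
theorem measurable_ncard_neighborSet {Ω : Type*} {m : MeasurableSpace Ω} {E : Ω → SimpleGraph Node}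
    (hE : ∀ ω, IsRootedTree (E ω)) (hadj : ∀ u v, MeasurableSet {ω | (E ω).Adj u v}) (u : Node) :
    Measurable fun ω => ((E ω).neighborSet u).ncard := by
  classical
  have h1 : Measurable fun ω => {i | (E ω).Adj u (i :: u)}.ncard := by
    refine measurable_of_Ioi fun i => ?_
    have : (fun ω => {i | (E ω).Adj u (i :: u)}.ncard) ⁻¹' Set.Ioi i =
        {ω | (E ω).Adj u (i :: u)} := by
      ext ω; exact ((hE ω).adj_child_iff u i).symm
    rw [this]
    exact hadj _ _
  have h2 : Measurable fun ω => if (E ω).Adj u u.tail then 1 else 0 :=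
    Measurable.ite (hadj _ _) measurable_const measurable_const
  simp only [fun ω => (hE ω).ncard_neighborSet u]
  exact h1.add h2

theorem measurableSet_or_pos {Ω : Type*} {m : MeasurableSpace Ω} {d : Ω → ℕ} (hd : Measurable d)
    (q : Prop) : MeasurableSet {ω | q ∨ 0 < d ω} :=
  (MeasurableSet.const q).union (hd (measurableSet_Ioi (a := 0)))

theorem measurableSet_le_sum_range {Ω : Type*} {m : MeasurableSpace Ω} {d : Ω → ℕ}
    (hd : Measurable d) {X : ℕ → Ω → ℝ} (hX : ∀ i, Measurable (X i)) {Y : Ω → ℝ}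
    (hY : Measurable Y) : MeasurableSet {ω | Y ω ≤ ∑ i ∈ Finset.range (d ω), X i ω} :=
  measurableSet_le hY (measurable_sum_range hd hX)

/-! ### Local information and the events it determines. -/

namespace Model

variable {p : Params} {Ω : Type*} [MeasurableSpace Ω] {μ : Measure Ω} (M : Model p μ)

/-- The event that `u` is a node of the network, of degree `k`. -/
def slot (u : Node) (k : ℕ) : Set Ω := {ω | M.deg u ω = k} ∩ M.inUse u

/-- The event that `u` adopts within `n` steps when influence is only passed towards the root. -/
def downEvent (n : ℕ) (u : Node) : Set Ω := {ω | AdoptsDown (M.skel ω) (M.thr ω) (M.wt ω) n u}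

/-- The contribution of the `i`-th child of `u` to the influence on `u` after `n` steps. -/
def contrib (n : ℕ) (u : Node) (i : ℕ) (ω : Ω) : ℝ :=
  ∑ᶠ _ : (M.skel ω).Adj u (i :: u) ∧ AdoptsDown (M.skel ω) (M.thr ω) (M.wt ω) n (i :: u),
    M.wt ω s(u, i :: u)

/-- The information on the skeleton. -/
@[reducible] def skelInfo : MeasurableSpace Ω :=
  ⨆ (u : Node) (v : Node), MeasurableSpace.comap (fun ω' => (M.skel ω').Adj u v) ⊤

theorem measurableSet_adj_skelInfo (u v : Node) :
    MeasurableSet[M.skelInfo] {ω | (M.skel ω).Adj u v} := by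
  have h : MeasurableSpace.comap (fun ω' => (M.skel ω').Adj u v) ⊤ ≤ M.skelInfo :=
    le_iSup₂_of_le u v le_rfl
  exact h _ ⟨{x | x}, trivial, rfl⟩

theorem skelInfo_le : M.skelInfo ≤ (inferInstance : MeasurableSpace Ω) := by
  refine iSup₂_le fun u v => ?_
  exact Measurable.comap_le (measurable_to_prop (by
    simpa [Set.preimage] using M.measurable_adj u v))

theorem measurable_deg_skelInfo (u : Node) : Measurable[M.skelInfo] (M.deg u) :=
  measurable_ncard_neighborSet M.isRootedTree M.measurableSet_adj_skelInfo u

theorem measurable_deg (u : Node) : Measurable (M.deg u) :=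
  (M.measurable_deg_skelInfo u).mono M.skelInfo_le le_rfl

theorem measurableSet_inUse (u : Node) : MeasurableSet (M.inUse u) :=
  measurableSet_or_pos (M.measurable_deg u) _

theorem measurableSet_slot (u : Node) (k : ℕ) : MeasurableSet (M.slot u k) :=
  (M.measurable_deg u (measurableSet_singleton k)).inter (M.measurableSet_inUse u)

theorem measurableSet_slot_skelInfo (u : Node) (k : ℕ) : MeasurableSet[M.skelInfo] (M.slot u k) :=
  MeasurableSet.inter (M.measurable_deg_skelInfo u (measurableSet_singleton k))
    (measurableSet_or_pos (M.measurable_deg_skelInfo u) _)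

/-! Measurability with respect to the information on a set of nodes. -/

section Info

variable {S : Set Node}

theorem measurable_deg_info {u : Node} (hu : u ∈ S) : Measurable[M.info S] (M.deg u) :=
  measurable_iff_comap_le.2 (le_sup_of_le_left (le_iSup₂_of_le u hu le_sup_left))

theorem measurable_thr_info {u : Node} (hu : u ∈ S) :
    Measurable[M.info S] ((M.inUse u).indicator fun ω => M.thr ω u) :=
  measurable_iff_comap_le.2 (le_sup_of_le_left (le_iSup₂_of_le u hu le_sup_right))

theorem measurableSet_adj_info {u v : Node} (hu : u ∈ S) (hv : v ∈ S) :
    MeasurableSet[M.info S] {ω | (M.skel ω).Adj u v} := by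
  have h : MeasurableSpace.comap (fun ω' => (M.skel ω').Adj u v) ⊤ ≤ M.info S :=
    le_sup_of_le_right (le_iSup₂_of_le u hu (le_iSup₂_of_le v hv le_sup_left))
  exact h _ ⟨{x | x}, trivial, rfl⟩

theorem measurable_wt_info {u v : Node} (hu : u ∈ S) (hv : v ∈ S) :
    Measurable[M.info S] ({ω | (M.skel ω).Adj u v}.indicator fun ω => M.wt ω s(u, v)) :=
  measurable_iff_comap_le.2
    (le_sup_of_le_right (le_iSup₂_of_le u hu (le_iSup₂_of_le v hv le_sup_right)))

theorem info_le (S : Set Node) : M.info S ≤ (inferInstance : MeasurableSpace Ω) := by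
  refine sup_le (iSup₂_le fun u _ => sup_le ?_ ?_)
    (iSup₂_le fun u _ => iSup₂_le fun v _ => sup_le ?_ ?_)
  · exact (M.measurable_deg u).comap_le
  · exact ((M.measurable_thr u).indicator (M.measurableSet_inUse u)).comap_le
  · exact Measurable.comap_le (measurable_to_prop (by
      simpa [Set.preimage] using M.measurable_adj u v))
  · exact ((M.measurable_wt _).indicator (M.measurable_adj u v)).comap_le

theorem info_mono {S T : Set Node} (h : S ⊆ T) : M.info S ≤ M.info T := by
  refine sup_le (iSup₂_le fun u hu => le_sup_of_le_left (le_iSup₂_of_le u (h hu) le_rfl))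
    (iSup₂_le fun u hu => iSup₂_le fun v hv => le_sup_of_le_right
      (le_iSup₂_of_le u (h hu) (le_iSup₂_of_le v (h hv) le_rfl)))

theorem inUse_of_adj {ω : Ω} {u v : Node} (h : (M.skel ω).Adj u v) : ω ∈ M.inUse u :=
  Or.inr ((M.isRootedTree ω).ncard_pos_of_adj h)

theorem contrib_eq_zero {n : ℕ} {u : Node} {i : ℕ} {ω : Ω} (h : ¬ (M.skel ω).Adj u (i :: u)) :
    M.contrib n u i ω = 0 := by
  classical
  rw [contrib, finsum_eq_if, if_neg fun h' => h h'.1]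

theorem contrib_eq_indicator (n : ℕ) (u : Node) (i : ℕ) : M.contrib n u i =
    (M.downEvent n (i :: u) ∩ M.inUse (i :: u)).indicator
      ({ω | (M.skel ω).Adj u (i :: u)}.indicator fun ω => M.wt ω s(u, i :: u)) := by
  classical
  ext ω
  rw [contrib, finsum_eq_if, Set.indicator_apply, Set.indicator_apply]
  by_cases h : (M.skel ω).Adj u (i :: u)
  · have := M.inUse_of_adj h.symm
    simp [downEvent, h, this]
  · simp [h]

theorem adoptsDown_succ_iff {ω : Ω} {n : ℕ} {u : Node} {s : Finset ℕ}
    (hs : ∀ i, (M.skel ω).Adj u (i :: u) → i ∈ s) :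
    AdoptsDown (M.skel ω) (M.thr ω) (M.wt ω) (n + 1) u ↔
      M.thr ω u ≤ ∑ i ∈ s, M.contrib n u i ω := by
  rw [AdoptsDown, finsum_eq_sum_of_support_subset]
  · rfl
  · intro i hi
    by_contra his
    exact hi (M.contrib_eq_zero fun h => his (hs i h))

theorem measurable_contrib_info {n : ℕ} {u : Node} {i : ℕ} (hu : u ∈ S)
    (hS : subtree (i :: u) ⊆ S) (h : MeasurableSet[M.info (subtree (i :: u))]
      (M.downEvent n (i :: u) ∩ M.inUse (i :: u))) : Measurable[M.info S] (M.contrib n u i) := by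
  rw [M.contrib_eq_indicator]
  exact Measurable.indicator (M.measurable_wt_info hu (hS List.suffix_rfl)) (M.info_mono hS _ h)

/-- The influence of a child is determined by the edge to it, its weight, and the child's own
subtree, whence the induction. The intersection with `inUse` is needed because thresholds of unused
labels are not recorded. -/
theorem measurableSet_downEvent_info : ∀ (n : ℕ) (u : Node),
    MeasurableSet[M.info (subtree u)] (M.downEvent n u ∩ M.inUse u)
  | 0, u => by
    have hu : u ∈ subtree u := List.suffix_rfl
    have h := MeasurableSet.inter (M.measurable_thr_info hu (measurableSet_singleton 0))
      (measurableSet_or_pos (M.measurable_deg_info hu) (u = root))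
    convert h using 1
    ext ω
    refine and_congr_left fun hω => ?_
    simp [downEvent, AdoptsDown, Set.indicator_of_mem (show ω ∈ M.inUse u from hω)]
  | n + 1, u => by
    have hu : u ∈ subtree u := List.suffix_rfl
    have hX : ∀ i, Measurable[M.info (subtree u)] (M.contrib n u i) := fun i =>
      M.measurable_contrib_info hu (child_subtree_subset u i)
        (measurableSet_downEvent_info n (i :: u))
    have h := MeasurableSet.inter
      (measurableSet_le_sum_range (M.measurable_deg_info hu) hX (M.measurable_thr_info hu))
      (measurableSet_or_pos (M.measurable_deg_info hu) (u = root))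
    convert h using 1
    ext ω
    refine and_congr_left fun hω => ?_
    change AdoptsDown (M.skel ω) (M.thr ω) (M.wt ω) (n + 1) u ↔
      (M.inUse u).indicator (fun ω => M.thr ω u) ω ≤ ∑ i ∈ Finset.range (M.deg u ω), M.contrib n u i ω
    rw [Set.indicator_of_mem (show ω ∈ M.inUse u from hω)]
    refine M.adoptsDown_succ_iff fun i hi => ?_
    rw [Finset.mem_range]
    refine (((M.isRootedTree ω).adj_child_iff_lt hω i).1 hi).trans_le ?_
    rw [numChildren]
    split_ifs
    · exact le_rfl
    · exact Nat.sub_le _ _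

/-- There are no loops, so the edge part of the information at `v` is trivial. What remains is the
degree, constant on the slot, and the threshold. -/
theorem exists_eq_slot_inter {v : Node} {k : ℕ} {G : Set Ω} (hG : MeasurableSet[M.info {v}] G)
    (hk : G ⊆ M.slot v k) : ∃ B : Set ℝ, MeasurableSet B ∧ G = M.slot v k ∩ {ω | M.thr ω v ∈ B} := by
  have hle : M.info {v} ≤ MeasurableSpace.comap
      (fun ω => (M.deg v ω, (M.inUse v).indicator (fun ω => M.thr ω v) ω)) inferInstance := by
    have hbot : ∀ {β : Type} {mβ : MeasurableSpace β} (f : Ω → β) (b : β), (∀ ω, f ω = b) →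
        MeasurableSpace.comap f mβ = ⊥ := fun f b h => by
      rw [funext h]; exact MeasurableSpace.comap_const b
    refine sup_le (iSup₂_le fun u hu => ?_) (iSup₂_le fun u hu => iSup₂_le fun w hw => ?_)
    · rw [Set.mem_singleton_iff.1 hu]
      exact (MeasurableSpace.comap_prodMk (M.deg v)
        ((M.inUse v).indicator fun ω => M.thr ω v)).ge
    · rw [Set.mem_singleton_iff.1 hu, Set.mem_singleton_iff.1 hw]
      refine sup_le (le_of_eq_of_le (hbot _ False fun ω => ?_) bot_le)
        (le_of_eq_of_le (hbot _ 0 fun ω => ?_) bot_le)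
      · simp
      · simp
  obtain ⟨T, hT, rfl⟩ := hle _ hG
  refine ⟨{x | (k, x) ∈ T}, measurable_prodMk_left hT, ?_⟩
  ext ω
  have key : ω ∈ M.slot v k → ((M.deg v ω, (M.inUse v).indicator (fun ω => M.thr ω v) ω) ∈ T ↔
      (k, M.thr ω v) ∈ T) := fun h => by
    rw [Set.indicator_of_mem h.2, show M.deg v ω = k from h.1]
  exact ⟨fun h => ⟨hk h, (key (hk h)).1 h⟩, fun h => (key h.1).2 h.2⟩

theorem measurableSet_slot_info {v : Node} (hv : v ∈ S) (k : ℕ) :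
    MeasurableSet[M.info S] (M.slot v k) :=
  MeasurableSet.inter (M.measurable_deg_info hv (measurableSet_singleton k))
    (measurableSet_or_pos (M.measurable_deg_info hv) _)

theorem measurableSet_slot_thr_info {v : Node} (hv : v ∈ S) (k : ℕ) {B : Set ℝ}
    (hB : MeasurableSet B) : MeasurableSet[M.info S] (M.slot v k ∩ {ω | M.thr ω v ∈ B}) := by
  have h := MeasurableSet.inter (M.measurableSet_slot_info hv k) (M.measurable_thr_info hv hB)
  convert h using 1
  ext ω
  refine and_congr_right fun hω => ?_
  rw [Set.mem_preimage, Set.indicator_of_mem hω.2]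
  rfl

theorem measurableSet_slot_thr (v : Node) (k : ℕ) {B : Set ℝ} (hB : MeasurableSet B) :
    MeasurableSet (M.slot v k ∩ {ω | M.thr ω v ∈ B}) :=
  (M.measurableSet_slot v k).inter (M.measurable_thr v hB)

end Info

/-! ### Product formulas from LTIA and from the law given the skeleton. -/

section Independence

variable [IsProbabilityMeasure μ]

/-- Independence of the information on both sides of a node `v` of degree `k`. -/
theorem LTIA.measureReal_inter {M : Model p μ} (hM : M.LTIA) {v : Node} {k : ℕ} {S₁ S₂ : Set Node}
    (hS : S₁ ∩ S₂ = {v}) (h₁ : (labelTree.induce S₁).Preconnected)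
    (h₂ : (labelTree.induce S₂).Preconnected) {A₁ A₂ : Set Ω} (hA₁ : MeasurableSet[M.info S₁] A₁)
    (hA₂ : MeasurableSet[M.info S₂] A₂) {c : ℝ}
    (hc : ∀ B, MeasurableSet B → μ.real (A₁ ∩ (M.slot v k ∩ {ω | M.thr ω v ∈ B})) =
      c * μ.real (M.slot v k ∩ {ω | M.thr ω v ∈ B})) {B : Set ℝ} (hB : MeasurableSet B) :
    μ.real (A₁ ∩ A₂ ∩ (M.slot v k ∩ {ω | M.thr ω v ∈ B})) =
      c * μ.real (A₂ ∩ (M.slot v k ∩ {ω | M.thr ω v ∈ B})) := by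
  have hv : v ∈ ({v} : Set Node) := rfl
  refine measureReal_inter_of_condIndep (M.info_le {v}) (M.info_le _ _ hA₁) (M.info_le _ _ hA₂)
    (M.measurableSet_slot_info hv k) (hM v S₁ S₂ hS h₁ h₂ A₁ A₂ hA₁ hA₂) (fun G hG hGH => ?_)
    (M.measurableSet_slot_thr_info hv k hB) Set.inter_subset_left
  obtain ⟨B, hB, rfl⟩ := M.exists_eq_slot_inter hG hGH
  exact hc B hB

/-- The law of thresholds and weights on an event that only depends on the skeleton. -/
theorem measureReal_inter_skel {S T : Finset Node} {B D : Node → Set ℝ}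
    (hB : ∀ u, MeasurableSet (B u)) (hD : ∀ c, MeasurableSet (D c)) (d : Node → ℕ) {A : Set Ω}
    (hA : MeasurableSet[M.skelInfo] A) (hS : ∀ u ∈ S, A ⊆ M.slot u (d u))
    (hT : ∀ c ∈ T, ∀ ω ∈ A, (M.skel ω).Adj c.tail c ∧ M.deg c.tail ω = d c.tail ∧ M.deg c ω = d c) :
    μ.real ({ω | (∀ u ∈ S, M.thr ω u ∈ B u) ∧ ∀ c ∈ T, M.wt ω s(c.tail, c) ∈ D c} ∩ A) =
      ((∏ u ∈ S, (p.F (d u)).real (B u)) * ∏ c ∈ T, (p.G (d c.tail) (d c)).real (D c)) *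
        μ.real A := by
  have hmeas : MeasurableSet
      {ω | (∀ u ∈ S, M.thr ω u ∈ B u) ∧ ∀ c ∈ T, M.wt ω s(c.tail, c) ∈ D c} := by
    have : {ω | (∀ u ∈ S, M.thr ω u ∈ B u) ∧ ∀ c ∈ T, M.wt ω s(c.tail, c) ∈ D c} =
        (⋂ u ∈ S, (fun ω => M.thr ω u) ⁻¹' B u) ∩ ⋂ c ∈ T, (fun ω => M.wt ω s(c.tail, c)) ⁻¹' D c := by
      ext; simp
    rw [this]
    exact (S.measurableSet_biInter fun u _ => M.measurable_thr u (hB u)).inter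
      (T.measurableSet_biInter fun c _ => M.measurable_wt _ (hD c))
  rw [← setIntegral_condExp_indicator M.skelInfo_le hmeas hA, mul_comm, ← smul_eq_mul,
    ← setIntegral_const]
  refine setIntegral_congr_ae (M.skelInfo_le _ hA) ?_
  filter_upwards [M.cond_law S T B D hB hD] with ω h hω
  rw [h (fun u hu => (hS u hu hω).2) fun c hc => (hT c hc ω hω).1]
  congr 1
  · exact Finset.prod_congr rfl fun u hu => by
      rw [show ((M.skel ω).neighborSet u).ncard = d u from (hS u hu hω).1]
  · exact Finset.prod_congr rfl fun c hc => by
      rw [show ((M.skel ω).neighborSet c.tail).ncard = d c.tail from (hT c hc ω hω).2.1,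
        show ((M.skel ω).neighborSet c).ncard = d c from (hT c hc ω hω).2.2]

theorem measureReal_thr_inter (u : Node) (k : ℕ) {B : Set ℝ} (hB : MeasurableSet B) {A : Set Ω}
    (hA : MeasurableSet[M.skelInfo] A) (hAu : A ⊆ M.slot u k) :
    μ.real (A ∩ {ω | M.thr ω u ∈ B}) = (p.F k).real B * μ.real A := by
  have h := M.measureReal_inter_skel (S := {u}) (T := ∅) (B := fun _ => B) (D := fun _ => ∅)
    (fun _ => hB) (fun _ => MeasurableSet.empty) (fun _ => k) hA (by simpa using hAu) (by simp)
  simpa [Set.inter_comm] using h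

end Independence
end Model

theorem Params.mixture_real (p : Params) {C : ℕ → ℝ} (hC : ∀ k ∈ p.K, C k ∈ Set.Icc (0 : ℝ) 1)
    (k : ℕ) {D : Set ℝ} (hD : MeasurableSet D) : (p.mixture C k).real D =
      ∑ j ∈ p.K, p.Q j * ((1 - C j) * D.indicator 1 0 + C j * (p.G k j).real D) := by
  have h := p.lintegral_mixture C k (D.indicator 1)
  simp only [lintegral_indicator_one hD] at h
  rw [measureReal_def, h, ENNReal.toReal_sum]
  · refine Finset.sum_congr rfl fun j hj => ?_
    have h0 : D.indicator (1 : ℝ → ENNReal) 0 ≠ ⊤ := by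
      by_cases h : (0 : ℝ) ∈ D <;> simp [h]
    rw [ENNReal.toReal_mul, ENNReal.toReal_ofReal (p.Q_nonneg hj), ENNReal.toReal_add
      (ENNReal.mul_ne_top ENNReal.ofReal_ne_top h0)
      (ENNReal.mul_ne_top ENNReal.ofReal_ne_top (measure_ne_top _ _)), ENNReal.toReal_mul,
      ENNReal.toReal_mul, ENNReal.toReal_ofReal (sub_nonneg.2 (hC j hj).2),
      ENNReal.toReal_ofReal (hC j hj).1, measureReal_def]
    congr 3
    by_cases h : (0 : ℝ) ∈ D <;> simp [h]
  · intro j _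
    refine ENNReal.mul_ne_top ENNReal.ofReal_ne_top (ENNReal.add_ne_top.2 ⟨?_, ?_⟩)
    · refine ENNReal.mul_ne_top ENNReal.ofReal_ne_top ?_
      by_cases h : (0 : ℝ) ∈ D <;> simp [h]
    · exact ENNReal.mul_ne_top ENNReal.ofReal_ne_top (measure_ne_top _ _)

/-! ### The law of the influence of the children. -/

namespace Model

variable {p : Params} {Ω : Type*} [MeasurableSpace Ω] {μ : Measure Ω} (M : Model p μ)

theorem adj_of_mem_slot_child {u : Node} {i j : ℕ} {ω : Ω} (h : ω ∈ M.slot (i :: u) j) :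
    (M.skel ω).Adj u (i :: u) :=
  (M.isRootedTree ω).adj_tail (List.cons_ne_nil _ _) (h.2.resolve_left (List.cons_ne_nil _ _))

theorem adj_iff_of_mem_slot {u : Node} {k : ℕ} {ω : Ω} (h : ω ∈ M.slot u k) (i : ℕ) :
    (M.skel ω).Adj u (i :: u) ↔ i < numChildren u k := by
  rw [(M.isRootedTree ω).adj_child_iff_lt h.2, show ((M.skel ω).neighborSet u).ncard = k from h.1]

theorem slot_child_zero (u : Node) (i : ℕ) : M.slot (i :: u) 0 = ∅ := by
  ext ω
  refine iff_of_false (fun h => ?_) (Set.notMem_empty _)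
  have h1 := h.2.resolve_left (List.cons_ne_nil _ _)
  rw [show M.deg (i :: u) ω = 0 from h.1] at h1
  exact lt_irrefl _ h1

theorem mem_slot_child_iff {u : Node} {i j : ℕ} {ω : Ω} (h : (M.skel ω).Adj u (i :: u)) :
    ω ∈ M.slot (i :: u) j ↔ M.deg (i :: u) ω = j :=
  and_iff_left (M.inUse_of_adj h.symm)

theorem measureReal_slot_inter_slot {u : Node} {k i j : ℕ} (hi : i < numChildren u k)
    (hj : j ∈ p.K) : μ.real (M.slot u k ∩ M.slot (i :: u) j) = p.Q j * μ.real (M.slot u k) := by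
  have h := M.edge_law u i k j hj
  have h1 : {ω | ((M.skel ω).neighborSet u).ncard = k ∧ (M.skel ω).Adj u (i :: u)} =
      M.slot u k := by
    ext ω
    exact ⟨fun h => ⟨h.1, M.inUse_of_adj h.2⟩, fun h => ⟨h.1, (M.adj_iff_of_mem_slot h i).2 hi⟩⟩
  have h2 : {ω | ((M.skel ω).neighborSet u).ncard = k ∧ (M.skel ω).Adj u (i :: u) ∧
        ((M.skel ω).neighborSet (i :: u)).ncard = j} = M.slot u k ∩ M.slot (i :: u) j := by
    ext ω
    constructor
    · exact fun h => ⟨⟨h.1, M.inUse_of_adj h.2.1⟩, (M.mem_slot_child_iff h.2.1).2 h.2.2⟩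
    · exact fun h => ⟨h.1.1, M.adj_of_mem_slot_child h.2, h.2.1⟩
  rw [h1, h2] at h
  rw [h, mul_comm]

theorem downEvent_succ_inter_slot (n : ℕ) (u : Node) (k : ℕ) :
    M.downEvent (n + 1) u ∩ M.slot u k =
      {ω | M.thr ω u ≤ ∑ i ∈ Finset.range (numChildren u k), M.contrib n u i ω} ∩ M.slot u k := by
  ext ω
  refine and_congr_left fun hω => ?_
  exact M.adoptsDown_succ_iff fun i hi => Finset.mem_range.2 ((M.adj_iff_of_mem_slot hω i).1 hi)

variable [IsProbabilityMeasure μ]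

theorem measureReal_deg_root_pos (hz : p.z = 0) : μ.real {ω | 0 < M.deg root ω} = 0 := by
  have hP : ∀ k ∈ p.K, k ≠ 0 → p.P k = 0 := by
    intro k hk hk0
    have := (Finset.sum_eq_zero_iff_of_nonneg
      fun j hj => mul_nonneg j.cast_nonneg (p.P_nonneg j hj)).1 hz k hk
    simpa [hk0] using this
  have h0 : 0 ∈ p.K := by
    by_contra h0
    have := p.P_sum
    rw [Finset.sum_eq_zero fun k hk => hP k hk (by rintro rfl; exact h0 hk)] at this
    exact zero_ne_one this
  have h1 : p.P 0 = 1 := by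
    rw [← p.P_sum, Finset.sum_eq_single 0 (fun k hk hk0 => hP k hk hk0) fun h => absurd h0 h]
  have h2 := M.root_law 0 h0
  have h3 : {ω | 0 < M.deg root ω} = {ω | ((M.skel ω).neighborSet root).ncard = 0}ᶜ := by
    ext ω; exact Nat.pos_iff_ne_zero
  have h4 : MeasurableSet {ω | ((M.skel ω).neighborSet root).ncard = 0} :=
    M.measurable_deg root (measurableSet_singleton 0)
  rw [h3, probReal_compl_eq_one_sub h4, h2, h1, sub_self]

/-- For `z ≠ 0` the values `Q j` sum to 1, so the degrees in `K` exhaust the slot. For `z = 0` any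
edge would force an edge at the root, which is a null event. -/
theorem measureReal_slot_inter_deg_notMem {u : Node} {k i : ℕ} (hi : i < numChildren u k) :
    μ.real (M.slot u k ∩ {ω | M.deg (i :: u) ω ∉ p.K}) = 0 := by
  by_cases hz : p.z = 0
  · refine measureReal_mono_null ?_ (M.measureReal_deg_root_pos hz)
    exact fun ω h => (M.isRootedTree ω).adj_root_of_adj ((M.adj_iff_of_mem_slot h.1 i).2 hi)
  · have hU : μ.real (⋃ j ∈ p.K, M.slot u k ∩ M.slot (i :: u) j) = μ.real (M.slot u k) := by
      rw [measureReal_biUnion_finset]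
      · rw [Finset.sum_congr rfl fun j hj => M.measureReal_slot_inter_slot hi hj, ← Finset.sum_mul,
          p.sum_Q, div_self hz, one_mul]
      · intro a _ b _ hab
        refine Set.disjoint_left.2 fun ω ha hb => hab ?_
        exact (show M.deg (i :: u) ω = a from ha.2.1).symm.trans hb.2.1
      · exact fun j _ => (M.measurableSet_slot _ _).inter (M.measurableSet_slot _ _)
    have hm : MeasurableSet (⋃ j ∈ p.K, M.slot u k ∩ M.slot (i :: u) j) :=
      p.K.measurableSet_biUnion fun j _ => (M.measurableSet_slot _ _).inter (M.measurableSet_slot _ _)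
    have hd : μ.real (M.slot u k \ ⋃ j ∈ p.K, M.slot u k ∩ M.slot (i :: u) j) = 0 := by
      rw [measureReal_sdiff (Set.iUnion₂_subset fun _ _ => Set.inter_subset_left) hm, hU, sub_self]
    refine measureReal_mono_null ?_ hd
    intro ω h
    refine ⟨h.1, fun hω => ?_⟩
    obtain ⟨j, hj, hω⟩ := Set.mem_iUnion₂.1 hω
    exact h.2 (by rw [show M.deg (i :: u) ω = j from hω.2.1]; exact hj)

/-- The factorization shows that, once the degree of the child is known, its threshold carries no
information on the parent or the connecting edge. This provides the constant needed to apply LTIA at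
the child. -/
theorem measureReal_pair (u : Node) (i k j : ℕ) {B B' D : Set ℝ} (hB : MeasurableSet B)
    (hB' : MeasurableSet B') (hD : MeasurableSet D) :
    μ.real ((M.slot u k ∩ {ω | M.thr ω u ∈ B}) ∩ {ω | M.wt ω s(u, i :: u) ∈ D} ∩
      (M.slot (i :: u) j ∩ {ω | M.thr ω (i :: u) ∈ B'})) =
      (p.F k).real B * (p.F j).real B' * (p.G k j).real D *
        μ.real (M.slot u k ∩ M.slot (i :: u) j) := by
  classical
  have hne : u ≠ i :: u := (List.cons_ne_self i u).symm
  have h := M.measureReal_inter_skel (S := {u, i :: u}) (T := {i :: u})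
    (B := fun x => if x = u then B else B') (D := fun _ => D)
    (fun x => by split_ifs <;> assumption) (fun _ => hD)
    (fun x => if x = u then k else j) (A := M.slot u k ∩ M.slot (i :: u) j)
    (MeasurableSet.inter (M.measurableSet_slot_skelInfo _ _) (M.measurableSet_slot_skelInfo _ _))
    (by
      intro x hx
      rcases Finset.mem_insert.1 hx with rfl | hx
      · simp
      · rw [Finset.mem_singleton.1 hx, if_neg hne.symm]; exact Set.inter_subset_right)
    (by
      intro x hx ω hω
      rw [Finset.mem_singleton.1 hx, if_neg hne.symm]
      exact ⟨M.adj_of_mem_slot_child hω.2, by simpa using hω.1.1, hω.2.1⟩)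
  rw [Finset.prod_pair hne, Finset.prod_singleton] at h
  simp only [List.tail_cons, if_true, if_neg hne.symm] at h
  rw [← h]
  congr 1
  ext ω
  simp [hne.symm]
  tauto

/-- The joint law of the adoption of a child, the weight of the edge to it, and the threshold of
its parent. -/
theorem measureReal_adopting_child (hM : M.LTIA) {n : ℕ} {u : Node} {i k j : ℕ}
    (hi : i < numChildren u k) (hj : j ∈ p.K) {c : ℝ}
    (hc : μ.real (M.downEvent n (i :: u) ∩ M.slot (i :: u) j) = c * μ.real (M.slot (i :: u) j))
    {B D : Set ℝ} (hB : MeasurableSet B) (hD : MeasurableSet D) :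
    μ.real ((M.slot u k ∩ {ω | M.thr ω u ∈ B}) ∩ {ω | M.wt ω s(u, i :: u) ∈ D} ∩
      (M.downEvent n (i :: u) ∩ M.slot (i :: u) j)) =
      p.Q j * (c * (p.G k j).real D) * μ.real (M.slot u k ∩ {ω | M.thr ω u ∈ B}) := by
  have hu : u ∈ ({u, i :: u} : Set Node) := Or.inl rfl
  have hcu : i :: u ∈ ({u, i :: u} : Set Node) := Or.inr rfl
  let A₁ : Set Ω := (M.slot u k ∩ {ω | M.thr ω u ∈ B}) ∩
    ({ω | (M.skel ω).Adj u (i :: u)} ∩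
      ({ω | (M.skel ω).Adj u (i :: u)}.indicator fun ω => M.wt ω s(u, i :: u)) ⁻¹' D)
  have hA₁ : MeasurableSet[M.info {u, i :: u}] A₁ :=
    MeasurableSet.inter (M.measurableSet_slot_thr_info hu k hB)
      (MeasurableSet.inter (M.measurableSet_adj_info hu hcu) (M.measurable_wt_info hu hcu hD))
  have hA₁s : ∀ X : Set Ω, A₁ ∩ (M.slot (i :: u) j ∩ X) =
      (M.slot u k ∩ {ω | M.thr ω u ∈ B}) ∩ {ω | M.wt ω s(u, i :: u) ∈ D} ∩
        (M.slot (i :: u) j ∩ X) := by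
    intro X
    ext ω
    refine and_congr_left fun hω => and_congr_right fun _ => ?_
    have hadj := M.adj_of_mem_slot_child hω.1
    refine (and_iff_right hadj).trans ?_
    rw [Set.mem_preimage, Set.indicator_of_mem
      (show ω ∈ {ω | (M.skel ω).Adj u (i :: u)} from hadj)]
    rfl
  -- LTIA at the child: the edge to the parent on one side, the child's subtree on the other. The
  -- constant is the probability of `A₁` given the child's slot; if that slot is null, the quotient
  -- is 0 by convention and the null case is settled separately.
  have key := hM.measureReal_inter (k := j) (pair_inter_subtree u i) (preconnected_pair u i)
    (preconnected_subtree (i :: u)) hA₁ (M.measurableSet_downEvent_info n (i :: u))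
    (c := (p.F k).real B * (p.G k j).real D * μ.real (M.slot u k ∩ M.slot (i :: u) j) /
      μ.real (M.slot (i :: u) j)) (fun B' hB' => ?_) MeasurableSet.univ
  · have e1 : A₁ ∩ (M.downEvent n (i :: u) ∩ M.inUse (i :: u)) ∩
        (M.slot (i :: u) j ∩ {ω | M.thr ω (i :: u) ∈ Set.univ}) =
        (M.slot u k ∩ {ω | M.thr ω u ∈ B}) ∩ {ω | M.wt ω s(u, i :: u) ∈ D} ∩
        (M.downEvent n (i :: u) ∩ M.slot (i :: u) j) := by
      have := hA₁s (M.downEvent n (i :: u))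
      rw [Set.inter_comm (M.downEvent n (i :: u)) (M.slot _ _), ← this]
      ext ω
      simp only [Set.mem_inter_iff, slot]
      simp
      tauto
    have e2 : (M.downEvent n (i :: u) ∩ M.inUse (i :: u)) ∩
        (M.slot (i :: u) j ∩ {ω | M.thr ω (i :: u) ∈ Set.univ}) =
        M.downEvent n (i :: u) ∩ M.slot (i :: u) j := by
      ext ω
      exact ⟨fun h => ⟨h.1.1, h.2.1⟩, fun h => ⟨⟨h.1, h.2.2⟩, h.2, trivial⟩⟩
    rw [e1, e2, hc] at key
    rw [key, M.measureReal_thr_inter u k hB (M.measurableSet_slot_skelInfo u k) subset_rfl]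
    by_cases h0 : μ.real (M.slot (i :: u) j) = 0
    · have h1 : μ.real (M.slot u k ∩ M.slot (i :: u) j) = 0 :=
        measureReal_mono_null Set.inter_subset_right h0
      rw [M.measureReal_slot_inter_slot hi hj] at h1
      rw [h0]
      linear_combination (-(c * (p.G k j).real D * (p.F k).real B)) * h1
    · rw [M.measureReal_slot_inter_slot hi hj]
      field_simp
  · rw [hA₁s, M.measureReal_pair u i k j hB hB' hD,
      M.measureReal_thr_inter (i :: u) j hB' (M.measurableSet_slot_skelInfo _ j) subset_rfl]
    by_cases h0 : μ.real (M.slot (i :: u) j) = 0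
    · have h1 : μ.real (M.slot u k ∩ M.slot (i :: u) j) = 0 :=
        measureReal_mono_null Set.inter_subset_right h0
      simp [h0, h1]
    · field_simp

/-- The law of the influence of a child on its parent, together with the threshold of the parent. -/
theorem measureReal_contrib (hM : M.LTIA) {n : ℕ} {u : Node} {i k : ℕ} (hi : i < numChildren u k)
    {C : ℕ → ℝ} (hC : ∀ j ∈ p.K, C j ∈ Set.Icc (0 : ℝ) 1)
    (hc : ∀ j ∈ p.K, 1 ≤ j →
      μ.real (M.downEvent n (i :: u) ∩ M.slot (i :: u) j) = C j * μ.real (M.slot (i :: u) j))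
    {B D : Set ℝ} (hB : MeasurableSet B) (hD : MeasurableSet D) :
    μ.real ({ω | M.contrib n u i ω ∈ D} ∩ (M.slot u k ∩ {ω | M.thr ω u ∈ B})) =
      (p.mixture C k).real D * μ.real (M.slot u k ∩ {ω | M.thr ω u ∈ B}) := by
  classical
  set W := M.slot u k ∩ {ω | M.thr ω u ∈ B} with hW
  set Y := {ω | M.contrib n u i ω ∈ D} with hY
  have hWm : MeasurableSet W := M.measurableSet_slot_thr u k hB
  have hXm : Measurable (M.contrib n u i) :=
    (M.measurable_contrib_info (S := subtree u) List.suffix_rfl (child_subtree_subset u i)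
      (M.measurableSet_downEvent_info n (i :: u))).mono (M.info_le _) le_rfl
  have hYm : MeasurableSet Y := hXm hD
  have hAm : MeasurableSet (M.downEvent n (i :: u) ∩ M.inUse (i :: u)) :=
    M.info_le _ _ (M.measurableSet_downEvent_info n (i :: u))
  have hadj : ∀ ω ∈ W, (M.skel ω).Adj u (i :: u) := fun ω hω => (M.adj_iff_of_mem_slot hω.1 i).2 hi
  have hsplit : μ.real (Y ∩ W) = ∑ j ∈ p.K, μ.real (Y ∩ (W ∩ M.slot (i :: u) j)) := by
    rw [← measureReal_biUnion_finset]
    · have hsub : (⋃ j ∈ p.K, Y ∩ (W ∩ M.slot (i :: u) j)) ⊆ Y ∩ W :=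
        Set.iUnion₂_subset fun _ _ ω h => ⟨h.1, h.2.1⟩
      refine le_antisymm ?_ (measureReal_mono hsub)
      have hcov : Y ∩ W ⊆ (⋃ j ∈ p.K, Y ∩ (W ∩ M.slot (i :: u) j)) ∪
          (M.slot u k ∩ {ω | M.deg (i :: u) ω ∉ p.K}) := by
        intro ω hω
        by_cases hd : M.deg (i :: u) ω ∈ p.K
        · exact Or.inl (Set.mem_iUnion₂.2 ⟨_, hd, hω.1, hω.2,
            (M.mem_slot_child_iff (hadj ω hω.2)).2 rfl⟩)
        · exact Or.inr ⟨hω.2.1, hd⟩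
      refine (measureReal_mono hcov).trans ((measureReal_union_le _ _).trans ?_)
      rw [M.measureReal_slot_inter_deg_notMem hi, add_zero]
    · intro a _ b _ hab
      refine Set.disjoint_left.2 fun ω ha hb => hab ?_
      exact (show M.deg (i :: u) ω = a from ha.2.2.1).symm.trans hb.2.2.1
    · exact fun j _ => hYm.inter (hWm.inter (M.measurableSet_slot _ _))
  rw [hsplit, p.mixture_real hC k hD, Finset.sum_mul]
  refine Finset.sum_congr rfl fun j hj => ?_
  -- A child has positive degree and `Q 0 = 0`, so the value of `C` at 0 plays no role.
  rcases Nat.eq_zero_or_pos j with rfl | hj1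
  · rw [M.slot_child_zero]
    simp [Params.Q]
  have hD' := M.measureReal_adopting_child hM hi hj (hc j hj hj1) hB hD
  have hU' := M.measureReal_adopting_child hM hi hj (hc j hj hj1) hB MeasurableSet.univ
  have hT' : μ.real (W ∩ M.slot (i :: u) j) = p.Q j * μ.real W := by
    have h1 := M.measureReal_thr_inter u k hB (A := M.slot u k ∩ M.slot (i :: u) j)
      (MeasurableSet.inter (M.measurableSet_slot_skelInfo u k) (M.measurableSet_slot_skelInfo _ j))
      Set.inter_subset_left
    have h2 := M.measureReal_thr_inter u k hB (M.measurableSet_slot_skelInfo u k) subset_rfl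
    rw [M.measureReal_slot_inter_slot hi hj] at h1
    rw [hW, h2, Set.inter_right_comm, h1]
    ring
  rw [← hW] at hD' hU'
  simp only [Set.mem_univ, Set.ofPred_true, Set.inter_univ, probReal_univ, mul_one] at hU'
  have hcontrib : ∀ ω ∈ W ∩ M.slot (i :: u) j, ω ∈ Y ↔
      (if ω ∈ M.downEvent n (i :: u) then M.wt ω s(u, i :: u) ∈ D else (0 : ℝ) ∈ D) := by
    intro ω hω
    rw [hY, Set.mem_ofPred_eq, contrib_eq_indicator, Set.indicator_apply,
      Set.indicator_of_mem
      (show ω ∈ {ω | (M.skel ω).Adj u (i :: u)} from hadj ω hω.1)]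
    have : ω ∈ M.inUse (i :: u) := hω.2.2
    by_cases h : ω ∈ M.downEvent n (i :: u) <;> simp [h, this]
  -- The influence is the edge weight if the child adopts and 0 otherwise; these cases yield the two
  -- terms of the mixture.
  have hin : μ.real (Y ∩ (W ∩ M.slot (i :: u) j) ∩ (M.downEvent n (i :: u) ∩ M.inUse (i :: u))) =
      p.Q j * (C j * (p.G k j).real D) * μ.real W := by
    rw [← hD']
    congr 1
    ext ω
    constructor
    · rintro ⟨⟨hy, hω⟩, hd, -⟩
      have := (hcontrib ω hω).1 hy
      rw [if_pos hd] at this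
      exact ⟨⟨hω.1, this⟩, hd, hω.2⟩
    · rintro ⟨⟨hw, hwt⟩, hd, hs⟩
      exact ⟨⟨(hcontrib ω ⟨hw, hs⟩).2 (by rwa [if_pos hd]), hw, hs⟩, hd, hs.2⟩
  have hout : μ.real ((Y ∩ (W ∩ M.slot (i :: u) j)) \ (M.downEvent n (i :: u) ∩ M.inUse (i :: u))) =
      p.Q j * ((1 - C j) * D.indicator 1 0) * μ.real W := by
    by_cases h0 : (0 : ℝ) ∈ D
    · have e : (Y ∩ (W ∩ M.slot (i :: u) j)) \ (M.downEvent n (i :: u) ∩ M.inUse (i :: u)) =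
          (W ∩ M.slot (i :: u) j) \ (M.downEvent n (i :: u) ∩ M.inUse (i :: u)) := by
        ext ω
        refine ⟨fun h => ⟨h.1.2, h.2⟩, fun h => ⟨⟨(hcontrib ω h.1).2 ?_, h.1⟩, h.2⟩⟩
        rw [if_neg fun hd => h.2 ⟨hd, h.1.2.2⟩]
        exact h0
      have h1 := measureReal_sdiff_add_inter (μ := μ) (s := W ∩ M.slot (i :: u) j) hAm
      have e2 : W ∩ M.slot (i :: u) j ∩ (M.downEvent n (i :: u) ∩ M.inUse (i :: u)) =
          W ∩ (M.downEvent n (i :: u) ∩ M.slot (i :: u) j) := by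
        ext ω; simp only [Set.mem_inter_iff, slot]; tauto
      rw [e2, hU', hT'] at h1
      rw [e, Set.indicator_of_mem h0, Pi.one_apply]
      linear_combination h1
    · rw [Set.indicator_of_notMem h0]
      have e : (Y ∩ (W ∩ M.slot (i :: u) j)) \ (M.downEvent n (i :: u) ∩ M.inUse (i :: u)) = ∅ := by
        ext ω
        refine iff_of_false (fun h => ?_) (Set.notMem_empty _)
        have := (hcontrib ω h.1.2).1 h.1.1
        rw [if_neg fun hd => h.2 ⟨hd, h.1.2.2.2⟩] at this
        exact h0 this
      simp [e]
  rw [← measureReal_sdiff_add_inter (μ := μ) hAm, hin, hout]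
  ring

/-- The law of the influence of several children on their parent, together with the threshold of
the parent. -/
theorem measureReal_sum_contrib (hM : M.LTIA) {n : ℕ} {u : Node} {k : ℕ} {C : ℕ → ℝ}
    (hC : ∀ j ∈ p.K, C j ∈ Set.Icc (0 : ℝ) 1)
    (hc : ∀ i, ∀ j ∈ p.K, 1 ≤ j →
      μ.real (M.downEvent n (i :: u) ∩ M.slot (i :: u) j) = C j * μ.real (M.slot (i :: u) j))
    {I : Finset ℕ} (hI : ∀ i ∈ I, i < numChildren u k) {B D : Set ℝ} (hB : MeasurableSet B)
    (hD : MeasurableSet D) :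
    μ.real ({ω | ∑ i ∈ I, M.contrib n u i ω ∈ D} ∩ (M.slot u k ∩ {ω | M.thr ω u ∈ B})) =
      (convPow (p.mixture C k) I.card).real D * μ.real (M.slot u k ∩ {ω | M.thr ω u ∈ B}) := by
  classical
  have hXi : ∀ (J : Set ℕ), ∀ i ∈ J, Measurable[M.info (branches u J)] (M.contrib n u i) :=
    fun J i hi => M.measurable_contrib_info (Or.inl rfl) (subtree_subset_branches hi)
      (M.measurableSet_downEvent_info n (i :: u))
  have hXm : ∀ i, Measurable (M.contrib n u i) := fun i =>
    (hXi {i} i rfl).mono (M.info_le _) le_rfl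
  have hsum : ∀ J : Finset ℕ, Measurable[M.info (branches u J)]
      fun ω => ∑ i ∈ J, M.contrib n u i ω := fun J =>
    Finset.measurable_fun_sum J fun i hi => hXi J i hi
  have hsumm : ∀ J : Finset ℕ, Measurable fun ω => ∑ i ∈ J, M.contrib n u i ω := fun J =>
    (hsum J).mono (M.info_le _) le_rfl
  induction I using Finset.induction_on generalizing D with
  | empty =>
    simp only [Finset.sum_empty, Finset.card_empty, convPow]
    by_cases h0 : (0 : ℝ) ∈ D
    · simp [h0, measureReal_def]
    · simp [h0, measureReal_def]
  | insert a I ha ih =>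
    have ih' := fun {D} (hD : MeasurableSet D) =>
      ih (fun i hi => hI i (Finset.mem_insert_of_mem hi)) (D := D) hD
    have hWm : MeasurableSet (M.slot u k ∩ {ω | M.thr ω u ∈ B}) := M.measurableSet_slot_thr u k hB
    set W := M.slot u k ∩ {ω | M.thr ω u ∈ B} with hW
    have hfin : IsFiniteMeasure (μ W • convPow (p.mixture C k) I.card) :=
      Measure.smul_finite _ (measure_ne_top _ _)
    -- Under `μ` restricted to `W` the partial sum and the new influence have a product law, the
    -- mass `μ W` being put into the first factor. Its image under addition is the next convolution
    -- power.
    have hjoint := map_prodMk_eq_prod (ν := μ.restrict W)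
      (X := fun ω => ∑ i ∈ I, M.contrib n u i ω) (Y := M.contrib n u a) (hsumm I) (hXm a)
      (α := μ W • convPow (p.mixture C k) I.card) (β := p.mixture C k) ?_
    · have hmap : (μ.restrict W).map (fun ω => ∑ i ∈ insert a I, M.contrib n u i ω) =
          μ W • convPow (p.mixture C k) (insert a I).card := by
        have e : (fun ω => ∑ i ∈ insert a I, M.contrib n u i ω) =
            (fun q : ℝ × ℝ => q.1 + q.2) ∘
              fun ω => (∑ i ∈ I, M.contrib n u i ω, M.contrib n u a ω) := by
          ext ω; simp [Finset.sum_insert ha, add_comm]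
        rw [e, ← Measure.map_map measurable_add ((hsumm I).prodMk (hXm a)), hjoint,
          Finset.card_insert_of_notMem ha, convPow, ← Measure.conv_smul_left]
        rfl
      have h2 := congrArg (fun m : Measure ℝ => m.real D) hmap
      simp only [map_measureReal_apply (hsumm (insert a I)) hD] at h2
      rw [measureReal_restrict_apply ((hsumm (insert a I)) hD)] at h2
      refine Eq.trans h2 ?_
      rw [measureReal_ennreal_smul_apply, mul_comm]
      rfl
    · intro D₂ D₁ hD₂ hD₁
      have hdisj : Disjoint ({a} : Set ℕ) (I : Set ℕ) :=
        Set.disjoint_singleton_left.2 (by simpa using ha)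
      -- LTIA at the parent: the new branch against the branches already treated. The law of a
      -- single influence, valid for every threshold event, supplies the constant.
      have key := hM.measureReal_inter (k := k) (branches_inter_branches u hdisj)
        (preconnected_branches u _) (preconnected_branches u _)
        (hXi {a} a rfl hD₁) (hsum I hD₂) (fun B' hB' => M.measureReal_contrib hM
          (hI a (Finset.mem_insert_self a I)) hC (hc a) hB' hD₁) hB
      have h3 := ih' hD₂
      rw [measureReal_restrict_apply ((hsumm I hD₂).inter (hXm a hD₁)), Set.inter_comm
        ((fun ω => ∑ i ∈ I, M.contrib n u i ω) ⁻¹' D₂), hW, key, measureReal_ennreal_smul_apply]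
      have h4 : μ.real ((fun ω => ∑ i ∈ I, M.contrib n u i ω) ⁻¹' D₂ ∩ W) = _ := h3
      rw [← hW, h4, ← measureReal_def]
      ring

/-- As the law of the sum is the same on every threshold event, sum and threshold are independent on
the slot. Integrating the distribution function of the threshold over the law of the sum gives the
response. -/
theorem measureReal_thr_le_sum (hM : M.LTIA) {n : ℕ} {u : Node} {k : ℕ} {C : ℕ → ℝ}
    (hC : ∀ j ∈ p.K, C j ∈ Set.Icc (0 : ℝ) 1)
    (hc : ∀ i, ∀ j ∈ p.K, 1 ≤ j →
      μ.real (M.downEvent n (i :: u) ∩ M.slot (i :: u) j) = C j * μ.real (M.slot (i :: u) j))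
    {I : Finset ℕ} (hI : ∀ i ∈ I, i < numChildren u k) :
    μ.real ({ω | M.thr ω u ≤ ∑ i ∈ I, M.contrib n u i ω} ∩ M.slot u k) =
      p.response C k I.card * μ.real (M.slot u k) := by
  have hXm : ∀ i, Measurable (M.contrib n u i) := fun i =>
    (M.measurable_contrib_info (S := subtree u) List.suffix_rfl (child_subtree_subset u i)
      (M.measurableSet_downEvent_info n (i :: u))).mono (M.info_le _) le_rfl
  have hsumm : Measurable fun ω => ∑ i ∈ I, M.contrib n u i ω :=
    Finset.measurable_fun_sum I fun i _ => hXm i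
  have hfin : IsFiniteMeasure (μ (M.slot u k) • convPow (p.mixture C k) I.card) :=
    Measure.smul_finite _ (measure_ne_top _ _)
  have hjoint := map_prodMk_eq_prod (ν := μ.restrict (M.slot u k))
      (X := fun ω => ∑ i ∈ I, M.contrib n u i ω) (Y := fun ω => M.thr ω u) hsumm
      (M.measurable_thr u) (α := μ (M.slot u k) • convPow (p.mixture C k) I.card) (β := p.F k) ?_
  · have hmeas : MeasurableSet {q : ℝ × ℝ | q.2 ≤ q.1} := measurableSet_le measurable_snd measurable_fst
    have h := congrArg (fun m : Measure (ℝ × ℝ) => m {q : ℝ × ℝ | q.2 ≤ q.1}) hjoint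
    simp only [Measure.map_apply (hsumm.prodMk (M.measurable_thr u)) hmeas,
      Measure.prod_apply hmeas, lintegral_smul_measure] at h
    rw [Measure.restrict_apply (hsumm.prodMk (M.measurable_thr u) hmeas)] at h
    rw [p.response_eq_toReal, measureReal_def, measureReal_def, ← ENNReal.toReal_mul, mul_comm]
    congr 1
    refine h.trans ?_
    rw [smul_eq_mul]
    congr 1
    refine lintegral_congr fun x => ?_
    rw [cdf_eq_real, ofReal_measureReal]
    rfl
  · intro D B hD hB
    have h1 := M.measureReal_sum_contrib hM hC hc hI hB hD
    rw [M.measureReal_thr_inter u k hB (M.measurableSet_slot_skelInfo u k) subset_rfl] at h1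
    rw [measureReal_restrict_apply ((hsumm hD).inter (M.measurable_thr u hB)),
      measureReal_ennreal_smul_apply, ← measureReal_def, Set.inter_assoc,
      Set.inter_comm ((fun ω => M.thr ω u) ⁻¹' B)]
    refine Eq.trans h1 ?_
    ring

/-- `F k` has no mass below 0, so its distribution function at 0 is the mass of the atom there. -/
theorem measureReal_thr_eq_zero (u : Node) (k : ℕ) :
    μ.real ({ω | M.thr ω u = 0} ∩ M.slot u k) = cdf (p.F k) 0 * μ.real (M.slot u k) := by
  rw [Set.inter_comm]
  refine (M.measureReal_thr_inter u k (measurableSet_singleton 0)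
    (M.measurableSet_slot_skelInfo u k) subset_rfl).trans ?_
  congr 1
  rw [cdf_eq_real, ← Set.Iio_union_right, measureReal_union (by simp) (measurableSet_singleton 0),
    measureReal_def (p.F k) (Set.Iio 0), p.F_nonneg k]
  simp

/-- The probability that a node adopts within `n` steps without regarding its parent. -/
theorem measureReal_downEvent (hM : M.LTIA) : ∀ (n : ℕ) (u : Node) (i : ℕ), ∀ j ∈ p.K, 1 ≤ j →
    μ.real (M.downEvent n (i :: u) ∩ M.slot (i :: u) j) =
      p.worIter n j * μ.real (M.slot (i :: u) j)
  | 0, u, i, j, _, _ => M.measureReal_thr_eq_zero (i :: u) j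
  | n + 1, u, i, j, _, _ => by
    rw [M.downEvent_succ_inter_slot, M.measureReal_thr_le_sum hM
      (fun l _ => p.worIter_mem_Icc n l)
      (fun l m hm hm1 => measureReal_downEvent hM n (i :: u) l m hm hm1)
      fun l hl => Finset.mem_range.1 hl, Finset.card_range]
    rfl

theorem measureReal_thr_le_sum_worIter (hM : M.LTIA) (n : ℕ) (u : Node) (k : ℕ) {I : Finset ℕ}
    (hI : ∀ i ∈ I, i < numChildren u k) :
    μ.real ({ω | M.thr ω u ≤ ∑ i ∈ I, M.contrib n u i ω} ∩ M.slot u k) =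
      p.response (p.worIter n) k I.card * μ.real (M.slot u k) :=
  M.measureReal_thr_le_sum hM (fun l _ => p.worIter_mem_Icc n l)
    (fun l m hm hm1 => M.measureReal_downEvent hM n u l m hm hm1) hI

end Model

/-! ### The conditional probabilities of adoption. -/

theorem cond_real_eq_of_inter {Ω : Type*} [MeasurableSpace Ω] {μ : Measure Ω} [IsFiniteMeasure μ]
    {s t : Set Ω} (hs : MeasurableSet s) (h0 : μ s ≠ 0) {c : ℝ}
    (h : μ.real (t ∩ s) = c * μ.real s) : (μ[|s]).real t = c := by
  rw [measureReal_def, cond_apply hs, ENNReal.toReal_mul, ENNReal.toReal_inv, ← measureReal_def,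
    ← measureReal_def, Set.inter_comm, h, mul_comm c, inv_mul_cancel_left₀]
  exact (measureReal_ne_zero_iff).2 h0

namespace Model

variable {p : Params} {Ω : Type*} [MeasurableSpace Ω] {μ : Measure Ω} (M : Model p μ)

theorem slot_root (k : ℕ) : M.slot root k = {ω | M.deg root ω = k} := by
  ext ω
  exact and_iff_left (Or.inl rfl)

theorem measure_deg_root_ne_zero {k : ℕ} (hk : k ∈ p.K) (hP : 0 < p.P k) :
    μ {ω | M.deg root ω = k} ≠ 0 := fun h => by
  have := M.root_law k hk
  rw [measureReal_def, show μ {ω | ((M.skel ω).neighborSet root).ncard = k} = 0 from h] at this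
  simp only [ENNReal.toReal_zero] at this
  exact hP.ne this

theorem tendsto_adoptProb (k : ℕ) :
    Tendsto (fun n => M.adoptProb n k) atTop (𝓝 (M.eventualProb k)) := by
  have hmono : Monotone fun n => {ω | root ∈ adopters (M.skel ω) (M.thr ω) (M.wt ω) n} :=
    fun m n hmn ω h => adopters_mono (M.isRootedTree ω).locallyFinite (M.wt_nonneg ω) hmn h
  have h := tendsto_measure_iUnion_atTop (μ := μ[|{ω | M.deg root ω = k}]) hmono
  have hU : {ω | ∃ n, root ∈ adopters (M.skel ω) (M.thr ω) (M.wt ω) n} =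
      ⋃ n, {ω | root ∈ adopters (M.skel ω) (M.thr ω) (M.wt ω) n} := by
    ext ω; simp
  rw [eventualProb, hU]
  exact (ENNReal.tendsto_toReal (measure_ne_top _ _)).comp h

variable [IsProbabilityMeasure μ]

/-- Once the degree is fixed, the edge to `[i]` exists always or never, so conditioning on it adds
nothing. Dropping child `i` leaves `k - 1` children. -/
theorem worProb_root_child (hM : M.LTIA) (n k i : ℕ)
    (h0 : μ {ω | M.deg root ω = k ∧ (M.skel ω).Adj root [i]} ≠ 0) :
    M.worProb n k root [i] = p.worIter n k := by
  obtain ⟨ω₀, hω₀⟩ := nonempty_of_measure_ne_zero h0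
  have hi : i < k := (M.adj_iff_of_mem_slot (u := root) (k := k) ⟨hω₀.1, Or.inl rfl⟩ i).1 hω₀.2
  have hs : {ω | M.deg root ω = k ∧ (M.skel ω).Adj root [i]} = M.slot root k := by
    ext ω
    exact ⟨fun h => ⟨h.1, Or.inl rfl⟩, fun h => ⟨h.1, (M.adj_iff_of_mem_slot h i).2 hi⟩⟩
  rw [worProb]
  rw [hs] at h0 ⊢
  refine cond_real_eq_of_inter (M.measurableSet_slot _ _) h0 ?_
  cases n with
  | zero => exact M.measureReal_thr_eq_zero root k
  | succ n =>
    have key := M.measureReal_thr_le_sum_worIter hM n root k (I := (Finset.range k).erase i)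
      fun j hj => Finset.mem_range.1 (Finset.mem_of_mem_erase hj)
    rw [Finset.card_erase_of_mem (Finset.mem_range.2 hi), Finset.card_range] at key
    refine Eq.trans (congrArg _ ?_) key
    ext ω
    refine and_congr_left fun hω => ?_
    refine (adoptsWOR_root_succ (M.isRootedTree ω) (M.wt_nonneg ω) n i).trans ?_
    have e : ∑ᶠ (j : ℕ) (_ : ((M.skel ω).Adj root [j] ∧
          AdoptsDown (M.skel ω) (M.thr ω) (M.wt ω) n [j]) ∧ j ≠ i), M.wt ω s(root, [j]) =
        ∑ j ∈ (Finset.range k).erase i, M.contrib n root j ω := by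
      classical
      rw [finsum_eq_sum_of_support_subset (s := (Finset.range k).erase i)]
      · refine Finset.sum_congr rfl fun j hj => ?_
        rw [contrib, finsum_eq_if, finsum_eq_if]
        simp only [and_iff_left (Finset.ne_of_mem_erase hj)]
      · intro j hj
        rw [Function.mem_support, finsum_eq_if] at hj
        have hj' := (ite_ne_right_iff.1 hj).1
        exact Finset.mem_coe.2 (Finset.mem_erase.2 ⟨hj'.2,
          Finset.mem_range.2 ((M.adj_iff_of_mem_slot hω j).1 hj'.1.1)⟩)
    rw [e]
    rfl

/-- Being in use and being joined to the root are the same for `[i]`; the root takes one of its `k`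
edges, and disregarding the root leaves the downward recursion. -/
theorem worProb_child_root (hM : M.LTIA) (n : ℕ) {k : ℕ} (hk : k ∈ p.K) (i : ℕ)
    (h0 : μ {ω | M.deg [i] ω = k ∧ (M.skel ω).Adj [i] root} ≠ 0) :
    M.worProb n k [i] root = p.worIter n k := by
  have hs : {ω | M.deg [i] ω = k ∧ (M.skel ω).Adj [i] root} = M.slot [i] k := by
    ext ω
    exact ⟨fun h => ⟨h.1, M.inUse_of_adj h.2⟩, fun h => ⟨h.1, (M.adj_of_mem_slot_child h).symm⟩⟩
  obtain ⟨ω₀, hω₀⟩ := nonempty_of_measure_ne_zero h0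
  have hk1 : 1 ≤ k := by
    rw [← hω₀.1]; exact (M.isRootedTree ω₀).ncard_pos_of_adj hω₀.2
  rw [worProb]
  rw [hs] at h0 ⊢
  refine cond_real_eq_of_inter (M.measurableSet_slot _ _) h0 ?_
  refine Eq.trans (congrArg _ ?_) (M.measureReal_downEvent hM n root i k hk hk1)
  ext ω
  exact and_congr_left fun _ => adoptsWOR_child (M.isRootedTree ω) (M.wt_nonneg ω) n i

theorem adoptProb_zero {k : ℕ} (hk : k ∈ p.K) (hP : 0 < p.P k) :
    M.adoptProb 0 k = cdf (p.F k) 0 := by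
  have h0 := M.measure_deg_root_ne_zero hk hP
  rw [adoptProb]
  rw [← slot_root] at h0 ⊢
  exact cond_real_eq_of_inter (M.measurableSet_slot _ _) h0 (M.measureReal_thr_eq_zero root k)

theorem adoptProb_succ (hM : M.LTIA) (n : ℕ) {k : ℕ} (hk : k ∈ p.K) (hP : 0 < p.P k) :
    M.adoptProb (n + 1) k = p.response (p.worIter n) k k := by
  have h0 := M.measure_deg_root_ne_zero hk hP
  rw [adoptProb]
  rw [← slot_root] at h0 ⊢
  refine cond_real_eq_of_inter (M.measurableSet_slot _ _) h0 ?_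
  have key := M.measureReal_thr_le_sum_worIter hM n root k (I := Finset.range k)
    fun j hj => Finset.mem_range.1 hj
  rw [Finset.card_range] at key
  refine Eq.trans (congrArg _ ?_) key
  refine Eq.trans ?_ (M.downEvent_succ_inter_slot n root k)
  ext ω
  exact and_congr_left fun _ => mem_adopters_root (M.isRootedTree ω) (M.wt_nonneg ω) (n + 1)

end Model

end Watts

end

theorem theorem1 (p : Watts.Params) {Ω : Type*} [MeasurableSpace Ω] (μ : Measure Ω)
    [IsProbabilityMeasure μ] (M : Watts.Model p μ) (hM : M.LTIA) :
    ∃ C : ℕ → ℕ → ℝ,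
      -- the WOR adoption probabilities, for an edge at the random node, from either end
      (∀ n, ∀ k ∈ p.K, ∀ v v' : Watts.Node, (v = Watts.root ∨ v' = Watts.root) →
        μ {ω | M.deg v ω = k ∧ (M.skel ω).Adj v v'} ≠ 0 → M.worProb n k v v' = C n k) ∧
      -- the initial values
      (∀ k ∈ p.K, 0 < p.P k → M.adoptProb 0 k = cdf (p.F k) 0 ∧
        (1 ≤ k → C 0 k = M.adoptProb 0 k)) ∧
      -- the recursion
      (∀ n, ∀ k ∈ p.K, 1 ≤ k → 0 < p.P k →
        Watts.HasFourierPairing (cdf (p.F k))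
          (fun ξ => Watts.fourierMeasure (p.mixture (C n) k) ξ ^ (k - 1)) (C (n + 1) k)) ∧
      -- the adoption probabilities
      (∀ n, ∀ k ∈ p.K, 0 < p.P k →
        Watts.HasFourierPairing (cdf (p.F k))
          (fun ξ => Watts.fourierMeasure (p.mixture (C n) k) ξ ^ k) (M.adoptProb (n + 1) k)) ∧
      -- the probabilities of eventual adoption, and the fixed point
      ∃ Cinf : ℕ → ℝ,
        (∀ k ∈ p.K, 1 ≤ k → Cinf k ∈ Set.Icc (0 : ℝ) 1 ∧
          Watts.HasFourierPairing (cdf (p.F k))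
            (fun ξ => Watts.fourierMeasure (p.mixture Cinf k) ξ ^ (k - 1)) (Cinf k)) ∧
        (∀ k ∈ p.K, 1 ≤ k → 0 < p.P k → Tendsto (fun n => C n k) atTop (𝓝 (Cinf k))) ∧
        ∀ k ∈ p.K, 0 < p.P k →
          Tendsto (fun n => M.adoptProb n k) atTop (𝓝 (M.eventualProb k)) ∧
          Watts.HasFourierPairing (cdf (p.F k))
            (fun ξ => Watts.fourierMeasure (p.mixture Cinf k) ξ ^ k) (M.eventualProb k) := by
  obtain ⟨L, hL⟩ := p.exists_tendsto_worIter
  have hC : ∀ n, ∀ k ∈ p.K, p.worIter n k ∈ Set.Icc (0 : ℝ) 1 := fun n k _ => p.worIter_mem_Icc n k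
  have hresp := fun k j => p.tendsto_response hC (fun i _ => hL i) k j
  refine ⟨p.worIter, ?_, ?_, ?_, ?_, L, ?_, fun k _ _ _ => hL k, ?_⟩
  · intro n k hk v v' hv h0
    obtain ⟨ω, hω⟩ := nonempty_of_measure_ne_zero h0
    have hle := (M.isRootedTree ω).le_labelTree
    rcases hv with rfl | rfl
    · rcases Watts.adj_cases hle hω.2 with rfl | ⟨i, rfl⟩
      · exact absurd rfl hω.2.ne
      · exact M.worProb_root_child hM n k i h0
    · rcases Watts.adj_cases hle hω.2.symm with rfl | ⟨i, rfl⟩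
      · exact absurd rfl hω.2.ne
      · exact M.worProb_child_root hM n hk i h0
  · exact fun k hk hP => ⟨M.adoptProb_zero hk hP, fun _ => (M.adoptProb_zero hk hP).symm⟩
  · exact fun n k _ _ _ => Watts.hasFourierPairing_pow (p.F k) _ _
  · intro n k hk hP
    rw [M.adoptProb_succ hM n hk hP]
    exact Watts.hasFourierPairing_pow (p.F k) _ _
  · intro k _ _
    refine ⟨isClosed_Icc.mem_of_tendsto (hL k)
      (Eventually.of_forall fun n => p.worIter_mem_Icc n k), ?_⟩
    -- The shifted iteration converges both to `L k` and, by continuity of the response, to the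
    -- response to `L`.
    have h : L k = p.response L k (k - 1) :=
      tendsto_nhds_unique ((tendsto_add_atTop_iff_nat 1).2 (hL k)) (hresp k (k - 1))
    have := Watts.hasFourierPairing_pow (p.F k) (p.mixture L k) (k - 1)
    rwa [← Watts.Params.response, ← h] at this
  · intro k hk hP
    have ht := M.tendsto_adoptProb k
    refine ⟨ht, ?_⟩
    have h : M.eventualProb k = p.response L k k :=
      tendsto_nhds_unique ((tendsto_add_atTop_iff_nat 1).2 ht)
        ((hresp k k).congr fun n => (M.adoptProb_succ hM n hk hP).symm)
    rw [h]
    exact Watts.hasFourierPairing_pow (p.F k) _ _
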